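/- Let $n\ge 1$. For measurable functions $f,g$ on $\mathbf R^n$ let $$\mathcal M_{\mathcal R}(f,g)(x)=\sup_{R\ni x}\Big(\frac1{|R|}\int_R|f(y)|\,dy\Big)\Big(\frac1{|R|}\int_R|g(y)|\,dy\Big),$$ where the supremum is over all open rectangles $R\subset\mathbf R^n$ containing $x$ with sides parallel to the coordinate axes. Let $\Phi_n(t)=t\,(1+(\log^+ t)^{n-1})$ for $t\ge 0$ (with $\Phi_n(0)=0$), where $(\log^+t)^0=1$, and let $\Phi_n^{(2)}=\Phi_n\circ\Phi_n$. For $1\le p<\infty$, let $L^p_{\Phi_n^{(2)}}(\mathbf R^n)$ be the class of measurable $f$ on $\mathbf R^n$ with $\int_{\mathbf R^n}\Phi_n^{(2)}(|f(x)|)^p\,dx<\infty$. Then there is a constant $C>0$ depending only on $n$ such that, for all $p\in(1,\infty)$, all $f\in L^1_{\Phi_n^{(2)}}(\mathbf R^n)$, all $g\in L^p_{\Phi_n^{(2)}}(\mathbf R^n)$ and all $\alpha>0$, $$\big|\{x\in\mathbf R^n:\ \mathcal M_{\mathcal R}(f,g)(x)>\alpha\}\big|\le C\left\{\int_{\mathbf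 R^n}\Phi_n^{(2)}\Big(\frac{|f(x)|}{\sqrt\alpha}\Big)dx\right\}^{\frac p{p+1}}\left\{\int_{\mathbf R^n}\Phi_n^{(2)}\Big(\frac{|g(x)|}{\sqrt\alpha}\Big)^p dx\right\}^{\frac1{p+1}}.$$ -/

import Mathlib

open MeasureTheory
open scoped ENNReal

noncomputable section

/-- The family of all (nondegenerate) bounded open rectangles in `ℝⁿ` with sides parallel to the
coordinate axes. -/
def openRectangles (n : ℕ) : Set (Set (Fin n → ℝ)) :=
  {R | ∃ a b : Fin n → ℝ, (∀ i, a i < b i) ∧ R = Set.univ.pi fun i => Set.Ioo (a i) (b i)}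

/-- The strong multilinear maximal function: the supremum, over the rectangles `R` containing `x`,
of the product of the averages of `|f i|` over `R`. -/
def strongMaximal {n m : ℕ} (f : Fin m → (Fin n → ℝ) → ℂ) (x : Fin n → ℝ) : ℝ≥0∞ :=
  ⨆ R ∈ openRectangles n, ⨆ _ : x ∈ R, ∏ i, ⨍⁻ y in R, ‖f i y‖ₑ ∂volume

/-- `Φ_n(t) = t (1 + (log⁺ t)^(n-1))`, used for `t ≥ 0` and `n ≥ 1`. -/
def Phi (n : ℕ) (t : ℝ) : ℝ := t * (1 + Real.posLog t ^ (n - 1))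

/-- The `m`-fold composition `Φ_n ∘ ⋯ ∘ Φ_n`. -/
def PhiIter (n m : ℕ) : ℝ → ℝ := (Phi n)^[m]

/-- `f ∈ L^p_Φ(ℝⁿ)`: `f` is measurable and `∫ Φ(|f|)^p < ∞`. -/
def MemLPhi {n : ℕ} (Φ : ℝ → ℝ) (p : ℝ) (f : (Fin n → ℝ) → ℂ) : Prop :=
  AEStronglyMeasurable f volume ∧ ∫⁻ x, ENNReal.ofReal (Φ ‖f x‖) ^ p < ∞

end

/-! Put F = |f|/√α and G = |g|/√α. The superlevel set is open, so by inner regularity and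
compactness it suffices to bound the union of a finite family of boxes R with |R|² ≤ ∫_R F · ∫_R G.

The Córdoba–Fefferman covering theorem `exists_subset_box_covering` selects a subfamily t whose
union Ω carries a fixed fraction of the total measure. The overlap of t is controlled by duality:
Σ_{R∈t} ∫_R φ ≤ 2|Ω| + C ∫ W(cφ), where W grows like t(log t)^(n-1). Applied to φ = (h/λ)^q on Ω,
with λ = `dualPhi n y` and y the L^q average of Φ(h) over Ω, this gives Σ ∫_R h^q ≤ (Cλ)^q |Ω|
(`exists_sum_setLIntegral_rpow_box_le`).

Hölder on each box, then over t, yields |Ω| ≤ (Σ ∫_R F)^(p/(p+1)) (Σ ∫_R G^p)^(1/(p+1)). Let x₁ be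
the L¹ average of Φ(F) over Ω and y₁ the L^p average of Φ(G). Cancelling |Ω| leaves 1 ≤ C ·
dualPhi(x₁) · dualPhi(y₁). The scalar inequality `exists_le_Phi_mul_Phi` turns this into c ≤
Φ(x₁)Φ(y₁), and the Jensen type bound `exists_Phi_rpow_mul_le_setLIntegral` moves the outer Φ inside
the averages. So one Φ pays for the overlap of the boxes and the other for the logarithms in
`dualPhi`.

Uniformity in p holds because every constant enters as C^q with C independent of q, and the final
exponents p/(p+1) are at most 1. -/

/-! ### Vitali covering by intervals on the line. -/

/-- The open interval with the given pair of end points. -/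
def interval (I : ℝ × ℝ) : Set ℝ := Set.Ioo I.1 I.2

/-- The open interval with the same centre as `interval I` and three times its length. -/
def tripleInterval (I : ℝ × ℝ) : Set ℝ := Set.Ioo (2 * I.1 - I.2) (2 * I.2 - I.1)

lemma measurableSet_interval (I : ℝ × ℝ) : MeasurableSet (interval I) := measurableSet_Ioo

lemma measurableSet_tripleInterval (I : ℝ × ℝ) : MeasurableSet (tripleInterval I) :=
  measurableSet_Ioo

lemma interval_subset_tripleInterval (I : ℝ × ℝ) : interval I ⊆ tripleInterval I := by
  intro x hx
  simp only [interval, tripleInterval, Set.mem_Ioo] at *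
  constructor <;> linarith

lemma volume_interval (I : ℝ × ℝ) : volume (interval I) = ENNReal.ofReal (I.2 - I.1) :=
  Real.volume_Ioo

lemma volume_interval_ne_top (I : ℝ × ℝ) : volume (interval I) ≠ ∞ := by
  simp [volume_interval]

lemma volume_interval_ne_zero {I : ℝ × ℝ} {x : ℝ} (hx : x ∈ interval I) :
    volume (interval I) ≠ 0 := by
  have := hx.1.trans hx.2
  simpa [volume_interval] using this

lemma volume_tripleInterval (I : ℝ × ℝ) :
    volume (tripleInterval I) = 3 * volume (interval I) := by
  rw [volume_interval, tripleInterval, Real.volume_Ioo, show (3 : ℝ≥0∞) = ENNReal.ofReal 3 by simp,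
    ← ENNReal.ofReal_mul (by norm_num)]
  congr 1; ring

lemma interval_subset_tripleInterval_of_inter {I J : ℝ × ℝ} (h : I.2 - I.1 ≤ J.2 - J.1)
    (hIJ : (interval I ∩ interval J).Nonempty) : interval I ⊆ tripleInterval J := by
  obtain ⟨z, hz, hz'⟩ := hIJ
  intro x hx
  simp only [interval, tripleInterval, Set.mem_Ioo] at *
  constructor <;> linarith

/-- Greedy choice by decreasing length: the induction adds the shortest interval last, so if it
meets a chosen interval it lies in the triple of that one. -/
lemma exists_disjoint_subset_triple_cover (s : Finset (ℝ × ℝ)) :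
    ∃ t ⊆ s, (t : Set (ℝ × ℝ)).PairwiseDisjoint interval ∧
      ∀ I ∈ s, interval I ⊆ ⋃ J ∈ t, tripleInterval J := by
  classical
  induction s using Finset.induction_on_min_value (fun I : ℝ × ℝ => I.2 - I.1) with
  | empty => exact ⟨∅, by simp⟩
  | insert a s ha hmin ih =>
    obtain ⟨t, hts, hd, hc⟩ := ih
    by_cases hmeet : ∃ J ∈ t, (interval a ∩ interval J).Nonempty
    · obtain ⟨J, hJ, hJa⟩ := hmeet
      refine ⟨t, hts.trans (Finset.subset_insert _ _), hd, ?_⟩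
      intro I hI
      rcases Finset.mem_insert.1 hI with rfl | hI
      · exact (interval_subset_tripleInterval_of_inter (hmin J (hts hJ)) hJa).trans
          (Set.subset_biUnion_of_mem (u := tripleInterval) hJ)
      · exact hc I hI
    · push Not at hmeet
      refine ⟨insert a t, Finset.insert_subset_insert _ hts, ?_, ?_⟩
      · rw [Finset.coe_insert]
        refine hd.insert fun J hJ _ => ?_
        exact Set.disjoint_iff_inter_eq_empty.2 (hmeet J hJ)
      · intro I hI
        rcases Finset.mem_insert.1 hI with rfl | hI
        · exact (interval_subset_tripleInterval I).trans
            (Set.subset_biUnion_of_mem (u := tripleInterval) (Finset.mem_insert_self _ _))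
        · exact (hc I hI).trans
            (Set.biUnion_subset_biUnion_left fun J hJ => Finset.mem_insert_of_mem hJ)

/-- The weak type `(1,1)` inequality for a finite family of intervals. -/
lemma mul_volume_biUnion_interval_le (s : Finset (ℝ × ℝ)) (c : ℝ≥0∞) (ψ : ℝ → ℝ≥0∞)
    (h : ∀ I ∈ s, c * volume (interval I) ≤ ∫⁻ y in interval I, ψ y) :
    c * volume (⋃ I ∈ s, interval I) ≤ 3 * ∫⁻ y, ψ y := by
  obtain ⟨t, hts, hd, hc⟩ := exists_disjoint_subset_triple_cover s
  calc c * volume (⋃ I ∈ s, interval I)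
      ≤ c * volume (⋃ J ∈ t, tripleInterval J) := by
        exact mul_le_mul_right (measure_mono (Set.iUnion₂_subset hc)) c
    _ ≤ c * ∑ J ∈ t, volume (tripleInterval J) := by
        gcongr
        exact measure_biUnion_finset_le _ _
    _ = 3 * ∑ J ∈ t, c * volume (interval J) := by
        simp only [volume_tripleInterval, Finset.mul_sum]
        exact Finset.sum_congr rfl fun _ _ => by ring
    _ ≤ 3 * ∑ J ∈ t, ∫⁻ y in interval J, ψ y := by
        gcongr with J hJ
        exact h J (hts hJ)
    _ = 3 * ∫⁻ y in ⋃ J ∈ t, interval J, ψ y := by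
        rw [lintegral_biUnion_finset hd fun J _ => measurableSet_interval J]
    _ ≤ 3 * ∫⁻ y, ψ y := by
        gcongr
        exact Measure.restrict_le_self

/-! ### Weak type estimates for the maximal function along one axis. -/

section AxisMaximal

variable {ι : Type*} [DecidableEq ι]

/-- The maximal function along the `i`-th coordinate axis over a finite family of intervals. -/
noncomputable def axisMaximal (𝓘 : Finset (ℝ × ℝ)) (i : ι) (φ : (ι → ℝ) → ℝ≥0∞) (x : ι → ℝ) :
    ℝ≥0∞ :=
  ⨆ I ∈ 𝓘, {z : ι → ℝ | z i ∈ interval I}.indicator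
    (fun z => (volume (interval I))⁻¹ * ∫⁻ y in interval I, φ (Function.update z i y)) x

lemma Measurable.axisMaximal {𝓘 : Finset (ℝ × ℝ)} {i : ι} {φ : (ι → ℝ) → ℝ≥0∞}
    (hφ : Measurable φ) : Measurable (axisMaximal 𝓘 i φ) := by
  refine Measurable.biSup _ 𝓘.countable_toSet fun I _ => ?_
  refine Measurable.indicator ?_ (measurable_pi_apply i (measurableSet_interval I))
  refine Measurable.const_mul ?_ _
  exact (hφ.comp measurable_update').lintegral_prod_right'

lemma average_le_axisMaximal {𝓘 : Finset (ℝ × ℝ)} {i : ι} (φ : (ι → ℝ) → ℝ≥0∞) {I : ℝ × ℝ}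
    (hI : I ∈ 𝓘) {x : ι → ℝ} (hx : x i ∈ interval I) :
    (volume (interval I))⁻¹ * ∫⁻ y in interval I, φ (Function.update x i y) ≤
      axisMaximal 𝓘 i φ x := by
  refine le_trans (le_of_eq ?_) (le_iSup₂ (f := fun I _ => {z : ι → ℝ | z i ∈ interval I}.indicator
    (fun z => (volume (interval I))⁻¹ * ∫⁻ y in interval I, φ (Function.update z i y)) x) I hI)
  rw [Set.indicator_of_mem (by exact hx)]

lemma lt_axisMaximal_iff {𝓘 : Finset (ℝ × ℝ)} {i : ι} {φ : (ι → ℝ) → ℝ≥0∞} {x : ι → ℝ} {c : ℝ≥0∞} :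
    c < axisMaximal 𝓘 i φ x ↔ ∃ I ∈ 𝓘, x i ∈ interval I ∧
      c < (volume (interval I))⁻¹ * ∫⁻ y in interval I, φ (Function.update x i y) := by
  simp only [axisMaximal, lt_iSup_iff]
  constructor
  · rintro ⟨I, hI, h⟩
    by_cases hx : x i ∈ interval I
    · rw [Set.indicator_of_mem (by exact hx)] at h
      exact ⟨I, hI, hx, h⟩
    · rw [Set.indicator_of_notMem (by exact hx)] at h
      simp at h
  · rintro ⟨I, hI, hx, h⟩
    refine ⟨I, hI, ?_⟩
    rwa [Set.indicator_of_mem (by exact hx)]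

lemma mul_volume_slice_axisMaximal_le (𝓘 : Finset (ℝ × ℝ)) (i : ι) (φ : (ι → ℝ) → ℝ≥0∞)
    (c : ℝ≥0∞) (x : ι → ℝ) :
    c * volume {y | c < axisMaximal 𝓘 i φ (Function.update x i y)} ≤
      3 * ∫⁻ y, φ (Function.update x i y) := by
  classical
  refine le_trans ?_ (mul_volume_biUnion_interval_le
    {I ∈ 𝓘 | c * volume (interval I) ≤ ∫⁻ y in interval I, φ (Function.update x i y)} c _
    fun I hI => (Finset.mem_filter.1 hI).2)
  gcongr
  intro y hy
  obtain ⟨I, hI, hyI, h⟩ := lt_axisMaximal_iff.1 hy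
  simp only [Function.update_self, Function.update_idem] at hyI h
  refine Set.mem_biUnion (Finset.mem_filter.2 ⟨hI, ?_⟩) hyI
  rw [← ENNReal.div_eq_inv_mul] at h
  exact (ENNReal.le_div_iff_mul_le (Or.inl (volume_interval_ne_zero hyI))
    (Or.inl (volume_interval_ne_top I))).1 h.le

/-- The maximal function acts on each line parallel to the axis separately, so the one-dimensional
bound integrates over the remaining variables by Fubini. -/
lemma mul_volume_axisMaximal_le [Fintype ι] (𝓘 : Finset (ℝ × ℝ)) (i : ι) {φ : (ι → ℝ) → ℝ≥0∞}
    (hφ : Measurable φ) (c : ℝ≥0∞) :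
    c * volume {x | c < axisMaximal 𝓘 i φ x} ≤ 3 * ∫⁻ x, φ x := by
  have hm : MeasurableSet {x | c < axisMaximal 𝓘 i φ x} :=
    measurableSet_lt measurable_const hφ.axisMaximal
  rw [← lintegral_const_mul _ hφ, ← lintegral_indicator_const hm]
  refine lintegral_le_of_lmarginal_le (μ := fun _ : ι => volume) {i}
    (measurable_const.indicator hm) (hφ.const_mul 3) ?_
  rw [lmarginal_singleton, lmarginal_singleton]
  intro x
  have hms : Measurable fun y => Function.update x i y := measurable_update x
  have := mul_volume_slice_axisMaximal_le 𝓘 i φ c x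
  dsimp only
  rw [lintegral_const_mul 3 (f := fun y => φ (Function.update x i y)) (hφ.comp hms)]
  refine le_trans (le_of_eq ?_) this
  exact lintegral_indicator_const (hms hm) c

/-- The weak type `(1,1)` inequality, localised to the large values of the function. -/
lemma mul_volume_axisMaximal_le_setLIntegral [Fintype ι] (𝓘 : Finset (ℝ × ℝ)) (i : ι) {φ : (ι → ℝ) → ℝ≥0∞}
    (hφ : Measurable φ) (c : ℝ≥0∞) :
    c * volume {x | c < axisMaximal 𝓘 i φ x} ≤
      3 * ∫⁻ x, {z | c < 2 * φ z}.indicator (fun z => 2 * φ z) x := by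
  have hm : MeasurableSet {z | c < 2 * φ z} := measurableSet_lt measurable_const (hφ.const_mul 2)
  refine le_trans ?_ (mul_volume_axisMaximal_le 𝓘 i ((hφ.const_mul 2).indicator hm) c)
  refine mul_le_mul_right (measure_mono fun x h => ?_) c
  obtain ⟨I, hI, hx, h⟩ := lt_axisMaximal_iff.1 (show c < axisMaximal 𝓘 i φ x from h)
  refine lt_axisMaximal_iff.2 ⟨I, hI, hx, ?_⟩
  by_contra! hle
  set v := volume (interval I)
  have hv0 : v ≠ 0 := volume_interval_ne_zero hx
  have hvt : v ≠ ∞ := volume_interval_ne_top I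
  have hms : Measurable fun y => Function.update x i y := measurable_update x
  -- Discarding the part of 2φ that is at most c lowers an average by at most c. An average of φ
  -- above c therefore leaves the truncated 2φ with an average above 2c - c = c.
  have key : 2 * (v⁻¹ * ∫⁻ y in interval I, φ (Function.update x i y)) ≤ c + c := by
    calc 2 * (v⁻¹ * ∫⁻ y in interval I, φ (Function.update x i y))
        = v⁻¹ * ∫⁻ y in interval I, 2 * φ (Function.update x i y) := by
          rw [lintegral_const_mul 2 (f := fun y => φ (Function.update x i y)) (hφ.comp hms)]; ring
      _ ≤ v⁻¹ * ∫⁻ y in interval I,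
            ({z | c < 2 * φ z}.indicator (fun z => 2 * φ z) (Function.update x i y) + c) := by
          gcongr with y
          by_cases hy : c < 2 * φ (Function.update x i y)
          · rw [Set.indicator_of_mem (by exact hy)]; exact le_self_add
          · exact (not_lt.1 hy).trans le_add_self
      _ = v⁻¹ * (∫⁻ y in interval I,
            {z | c < 2 * φ z}.indicator (fun z => 2 * φ z) (Function.update x i y)) + c := by
          rw [lintegral_add_right _ measurable_const, setLIntegral_const, mul_add, mul_comm c,
            ← mul_assoc v⁻¹ v, ENNReal.inv_mul_cancel hv0 hvt, one_mul]
      _ ≤ c + c := by gcongr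
  rw [← two_mul] at key
  have := (ENNReal.mul_le_mul_iff_right (by norm_num) (by norm_num)).1 key
  exact absurd h (not_lt.2 this)

end AxisMaximal

/-! ### The dyadic growth function. -/

/-- A dyadic version of the function `t (1 + log⁺ t) ^ j`, vanishing for `t ≤ 1`. -/
noncomputable def dyadicGrowth (j : ℕ) (t : ℝ≥0∞) : ℝ≥0∞ :=
  ∑' m : ℕ, {s : ℝ≥0∞ | 2 ^ m < s}.indicator (fun _ => 2 ^ (m + 1) * (m + 1) ^ j) t

lemma dyadicGrowth_zero_right (j : ℕ) : dyadicGrowth j 0 = 0 := by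
  simp [dyadicGrowth]

lemma two_pow_lt_iff_lt_find {t : ℝ≥0∞} (h : ∃ m : ℕ, t ≤ 2 ^ m) (m : ℕ) :
    2 ^ m < t ↔ m < Nat.find h := by
  rw [Nat.lt_find_iff]
  push Not
  constructor
  · intro hm k hk
    exact lt_of_le_of_lt (pow_le_pow_right₀ (by norm_num) hk) hm
  · intro hm
    exact hm m le_rfl

lemma exists_le_two_pow {t : ℝ≥0∞} (ht : t ≠ ∞) : ∃ m : ℕ, t ≤ 2 ^ m := by
  obtain ⟨m, hm⟩ := ENNReal.exists_nat_gt ht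
  refine ⟨m, hm.le.trans ?_⟩
  exact_mod_cast Nat.lt_two_pow_self.le

lemma dyadicGrowth_eq_sum {t : ℝ≥0∞} (h : ∃ m : ℕ, t ≤ 2 ^ m) (j : ℕ) :
    dyadicGrowth j t = ∑ m ∈ Finset.range (Nat.find h), (2 ^ (m + 1) * (m + 1) ^ j : ℝ≥0∞) := by
  rw [dyadicGrowth, tsum_eq_sum (s := Finset.range (Nat.find h))]
  · refine Finset.sum_congr rfl fun m hm => ?_
    rw [Set.indicator_of_mem]
    exact (two_pow_lt_iff_lt_find h m).2 (Finset.mem_range.1 hm)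
  · intro m hm
    rw [Set.indicator_of_notMem]
    exact fun h' => hm (Finset.mem_range.2 ((two_pow_lt_iff_lt_find h m).1 h'))

lemma dyadicGrowth_top (j : ℕ) : dyadicGrowth j ∞ = ∞ := by
  refine top_unique ?_
  calc (∞ : ℝ≥0∞) = ∑' _ : ℕ, (1 : ℝ≥0∞) := (ENNReal.tsum_const_eq_top_of_ne_zero one_ne_zero).symm
    _ ≤ dyadicGrowth j ∞ := by
      refine ENNReal.tsum_le_tsum fun m => ?_
      rw [Set.indicator_of_mem (by simp)]
      exact one_le_mul (one_le_pow₀ (by norm_num)) (one_le_pow₀ (by simp))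

lemma le_dyadicGrowth_zero_add_one (t : ℝ≥0∞) : t ≤ 1 + dyadicGrowth 0 t := by
  by_cases ht : t = ∞
  · simp [ht, dyadicGrowth_top]
  · have h := exists_le_two_pow ht
    rw [dyadicGrowth_eq_sum h]
    refine (Nat.find_spec h).trans ?_
    rcases Nat.eq_zero_or_pos (Nat.find h) with h0 | h0
    · simp [h0]
    · obtain ⟨k, hk⟩ := Nat.exists_eq_succ_of_ne_zero h0.ne'
      rw [hk, Finset.sum_range_succ]
      simp only [pow_zero, mul_one]
      exact le_add_self.trans le_add_self

/-- If 2^k < t ≤ 2^(k+1), the left side has k + 1 nonzero terms, each at most (k+1)^j. The resulting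
bound 2^(k+1) (k+1)^(j+1) is the last term of the sum on the right. -/
lemma mul_tsum_indicator_le_dyadicGrowth (j : ℕ) (t : ℝ≥0∞) :
    t * ∑' m : ℕ, {s : ℝ≥0∞ | 2 ^ m < s}.indicator (fun _ => ((m : ℝ≥0∞) + 1) ^ j) t ≤
      dyadicGrowth (j + 1) t := by
  by_cases ht : t = ∞
  · simp [ht, dyadicGrowth_top]
  · have h := exists_le_two_pow ht
    rw [dyadicGrowth_eq_sum h, tsum_eq_sum (s := Finset.range (Nat.find h))]
    · rcases Nat.eq_zero_or_pos (Nat.find h) with h0 | h0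
      · simp [h0]
      · obtain ⟨k, hk⟩ := Nat.exists_eq_succ_of_ne_zero h0.ne'
        have hspec := Nat.find_spec h
        rw [hk] at hspec ⊢
        calc t * ∑ m ∈ Finset.range k.succ,
              {s : ℝ≥0∞ | 2 ^ m < s}.indicator (fun _ => ((m : ℝ≥0∞) + 1) ^ j) t
            ≤ 2 ^ (k + 1) * ∑ m ∈ Finset.range k.succ, ((k : ℝ≥0∞) + 1) ^ j := by
              gcongr with m hm
              refine (Set.indicator_le_self' (fun _ _ => zero_le) _).trans ?_
              have : m ≤ k := Nat.lt_succ_iff.1 (Finset.mem_range.1 hm)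
              gcongr
          _ = 2 ^ (k + 1) * (k + 1) ^ (j + 1) := by
              rw [Finset.sum_const, Finset.card_range, nsmul_eq_mul]
              push_cast
              ring
          _ ≤ _ := by
              rw [Finset.sum_range_succ]
              exact le_add_self
    · intro m hm
      rw [Set.indicator_of_notMem]
      exact fun h' => hm (Finset.mem_range.2 ((two_pow_lt_iff_lt_find h m).1 h'))

/-! ### L log L estimates for iterated maximal functions. -/

section AxisMaximal

variable {ι : Type*} [DecidableEq ι]

/-- Layer cake over the levels 2^m with the localised weak type bound at each. Summing (m+1)^j over
the levels below 2φ produces one more logarithm: this is the cost of one axis. -/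
lemma lintegral_dyadicGrowth_axisMaximal_le [Fintype ι] (𝓘 : Finset (ℝ × ℝ)) (i : ι)
    {φ : (ι → ℝ) → ℝ≥0∞} (hφ : Measurable φ) (j : ℕ) :
    ∫⁻ x, dyadicGrowth j (axisMaximal 𝓘 i φ x) ≤ 6 * ∫⁻ x, dyadicGrowth (j + 1) (2 * φ x) := by
  have hm (m : ℕ) : MeasurableSet {s : ℝ≥0∞ | 2 ^ m < s} := measurableSet_Ioi
  have h2 : Measurable fun x => 2 * φ x := hφ.const_mul 2
  have hm2 (m : ℕ) : MeasurableSet {z | 2 ^ m < 2 * φ z} := h2 (hm m)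
  calc ∫⁻ x, dyadicGrowth j (axisMaximal 𝓘 i φ x)
      = ∑' m : ℕ, 2 ^ (m + 1) * (m + 1) ^ j * volume {x | 2 ^ m < axisMaximal 𝓘 i φ x} := by
        unfold dyadicGrowth
        refine (lintegral_tsum fun m =>
          ((measurable_const.indicator (hm m)).comp hφ.axisMaximal).aemeasurable).trans ?_
        congr! 2 with m
        exact lintegral_indicator_const (hφ.axisMaximal (hm m)) _
    _ ≤ ∑' m : ℕ, 6 * ∫⁻ x, {z | 2 ^ m < 2 * φ z}.indicator
          (fun z => 2 * φ z * ((m : ℝ≥0∞) + 1) ^ j) x := by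
        refine ENNReal.tsum_le_tsum fun m => ?_
        have := mul_volume_axisMaximal_le_setLIntegral 𝓘 i hφ (2 ^ m)
        calc (2 : ℝ≥0∞) ^ (m + 1) * (m + 1) ^ j * volume {x | 2 ^ m < axisMaximal 𝓘 i φ x}
            = 2 * (m + 1) ^ j * (2 ^ m * volume {x | 2 ^ m < axisMaximal 𝓘 i φ x}) := by ring
          _ ≤ 2 * (m + 1) ^ j *
              (3 * ∫⁻ x, {z | 2 ^ m < 2 * φ z}.indicator (fun z => 2 * φ z) x) := by gcongr
          _ = 6 * ((∫⁻ x, {z | 2 ^ m < 2 * φ z}.indicator (fun z => 2 * φ z) x) *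
                (m + 1) ^ j) := by ring
          _ = _ := by
            rw [← lintegral_mul_const _ (h2.indicator (hm2 m))]
            congr 1
            refine lintegral_congr fun x => ?_
            by_cases hx : 2 ^ m < 2 * φ x
            · rw [Set.indicator_of_mem (by exact hx), Set.indicator_of_mem (by exact hx)]
            · rw [Set.indicator_of_notMem (by exact hx), Set.indicator_of_notMem (by exact hx),
                zero_mul]
    _ = 6 * ∫⁻ x, 2 * φ x * ∑' m : ℕ,
          {s : ℝ≥0∞ | 2 ^ m < s}.indicator (fun _ => ((m : ℝ≥0∞) + 1) ^ j) (2 * φ x) := by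
        rw [ENNReal.tsum_mul_left, ← lintegral_tsum fun m =>
          ((h2.mul_const _).indicator (hm2 m)).aemeasurable]
        congr 1
        refine lintegral_congr fun x => ?_
        rw [← ENNReal.tsum_mul_left]
        congr! 2 with m
        by_cases hx : 2 ^ m < 2 * φ x
        · rw [Set.indicator_of_mem (by exact hx), Set.indicator_of_mem (by exact hx)]
        · rw [Set.indicator_of_notMem (by exact hx), Set.indicator_of_notMem (by exact hx), mul_zero]
    _ ≤ _ := by
        gcongr with x
        exact mul_tsum_indicator_le_dyadicGrowth j _

/-- The composition of the axis maximal functions along a list of coordinates. -/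
noncomputable def iteratedMaximal (𝓘 : Finset (ℝ × ℝ)) (l : List ι) (φ : (ι → ℝ) → ℝ≥0∞) :
    (ι → ℝ) → ℝ≥0∞ :=
  l.foldr (axisMaximal 𝓘) φ

lemma Measurable.iteratedMaximal {𝓘 : Finset (ℝ × ℝ)} {φ : (ι → ℝ) → ℝ≥0∞} (hφ : Measurable φ)
    (l : List ι) : Measurable (iteratedMaximal 𝓘 l φ) := by
  induction l with
  | nil => exact hφ
  | cons i l ih => exact ih.axisMaximal

lemma axisMaximal_const_mul {𝓘 : Finset (ℝ × ℝ)} {i : ι} {φ : (ι → ℝ) → ℝ≥0∞} (hφ : Measurable φ)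
    (c : ℝ≥0∞) : axisMaximal 𝓘 i (fun x => c * φ x) = fun x => c * axisMaximal 𝓘 i φ x := by
  ext x
  simp only [axisMaximal, ENNReal.mul_iSup]
  congr! 2 with I hI
  by_cases hx : x i ∈ interval I
  · rw [Set.indicator_of_mem (by exact hx), Set.indicator_of_mem (by exact hx),
      lintegral_const_mul c (f := fun y => φ (Function.update x i y))
        (hφ.comp (measurable_update x)), mul_left_comm]
  · rw [Set.indicator_of_notMem (by exact hx), Set.indicator_of_notMem (by exact hx), mul_zero]

lemma iteratedMaximal_const_mul {𝓘 : Finset (ℝ × ℝ)} {φ : (ι → ℝ) → ℝ≥0∞} (hφ : Measurable φ)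
    (l : List ι) (c : ℝ≥0∞) :
    iteratedMaximal 𝓘 l (fun x => c * φ x) = fun x => c * iteratedMaximal 𝓘 l φ x := by
  induction l with
  | nil => rfl
  | cons i l ih =>
    change axisMaximal 𝓘 i (iteratedMaximal 𝓘 l _) = _
    rw [ih, axisMaximal_const_mul (hφ.iteratedMaximal l)]
    rfl

/-- Each axis costs one logarithm, a factor 6 and a dilation of φ by 2. The dilation passes through
the remaining maximal functions by homogeneity. -/
lemma lintegral_dyadicGrowth_iteratedMaximal_le [Fintype ι] (𝓘 : Finset (ℝ × ℝ)) (l : List ι)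
    {φ : (ι → ℝ) → ℝ≥0∞} (hφ : Measurable φ) (j : ℕ) :
    ∫⁻ x, dyadicGrowth j (iteratedMaximal 𝓘 l φ x) ≤
      6 ^ l.length * ∫⁻ x, dyadicGrowth (j + l.length) (2 ^ l.length * φ x) := by
  induction l generalizing j φ with
  | nil => simp [iteratedMaximal]
  | cons i l ih =>
    calc ∫⁻ x, dyadicGrowth j (axisMaximal 𝓘 i (iteratedMaximal 𝓘 l φ) x)
        ≤ 6 * ∫⁻ x, dyadicGrowth (j + 1) (2 * iteratedMaximal 𝓘 l φ x) :=
          lintegral_dyadicGrowth_axisMaximal_le 𝓘 i (hφ.iteratedMaximal l) j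
      _ = 6 * ∫⁻ x, dyadicGrowth (j + 1) (iteratedMaximal 𝓘 l (fun x => 2 * φ x) x) := by
          rw [iteratedMaximal_const_mul hφ]
      _ ≤ 6 * (6 ^ l.length *
            ∫⁻ x, dyadicGrowth (j + 1 + l.length) (2 ^ l.length * (2 * φ x))) := by
          gcongr
          exact ih (hφ.const_mul 2) (j + 1)
      _ = _ := by
          have h (x : ι → ℝ) : 2 ^ l.length * (2 * φ x) = 2 ^ (l.length + 1) * φ x := by
            rw [pow_succ, mul_assoc]
          rw [← mul_assoc, ← pow_succ', List.length_cons, add_assoc, add_comm 1]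
          simp_rw [h]

end AxisMaximal

/-! ### Boxes and the Córdoba–Fefferman covering theorem. -/

section Boxes

variable {ι : Type*}

/-- The cylinder over a rectangle, restricting only the coordinates in `s`. -/
def boxOn (s : Finset ι) (R : ι → ℝ × ℝ) : Set (ι → ℝ) := {x | ∀ i ∈ s, x i ∈ interval (R i)}

/-- The open rectangle with the given sides. -/
def box (R : ι → ℝ × ℝ) : Set (ι → ℝ) := {x | ∀ i, x i ∈ interval (R i)}

/-- The rectangle `box R` enlarged three times in the direction `i₀`. -/
def stretchedBox (i₀ : ι) (R : ι → ℝ × ℝ) : Set (ι → ℝ) :=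
  {x | x i₀ ∈ tripleInterval (R i₀) ∧ ∀ i ≠ i₀, x i ∈ interval (R i)}

lemma box_eq_pi (R : ι → ℝ × ℝ) : box R = Set.univ.pi fun i => interval (R i) := by
  ext; simp [box]

lemma boxOn_univ [Fintype ι] (R : ι → ℝ × ℝ) : boxOn Finset.univ R = box R := by
  ext; simp [box, boxOn]

lemma box_subset_stretchedBox (i₀ : ι) (R : ι → ℝ × ℝ) : box R ⊆ stretchedBox i₀ R :=
  fun _ hx => ⟨interval_subset_tripleInterval _ (hx i₀), fun i _ => hx i⟩

lemma measurableSet_boxOn (s : Finset ι) (R : ι → ℝ × ℝ) : MeasurableSet (boxOn s R) := by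
  have : boxOn s R = ⋂ i ∈ s, {x | x i ∈ interval (R i)} := by ext; simp [boxOn]
  rw [this]
  exact Finset.measurableSet_biInter _ fun i _ =>
    measurable_pi_apply i (measurableSet_interval (R i))

/-- The base points x and x' may differ off s; this permits comparing slices taken at different
heights. -/
lemma lmarginal_le_lmarginal_of_forall [DecidableEq ι] {s : Finset ι} {f g : (ι → ℝ) → ℝ≥0∞} {x x' : ι → ℝ}
    (h : ∀ z z', (∀ i ∉ s, z i = x i) → (∀ i ∉ s, z' i = x' i) → (∀ i ∈ s, z i = z' i) →
      f z ≤ g z') :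
    lmarginal (fun _ => volume) s f x ≤ lmarginal (fun _ => volume) s g x' := by
  refine lintegral_mono fun y => h _ _ ?_ ?_ ?_ <;> intro i hi <;>
    simp [Function.updateFinset, hi]

lemma lmarginal_const_mul' [DecidableEq ι] {s : Finset ι} {f : (ι → ℝ) → ℝ≥0∞} (hf : Measurable f) (c : ℝ≥0∞)
    (x : ι → ℝ) :
    lmarginal (fun _ => volume) s (fun z => c * f z) x =
      c * lmarginal (fun _ => volume) s f x :=
  lintegral_const_mul c (hf.comp measurable_updateFinset)

lemma lmarginal_indicator_boxOn [DecidableEq ι] (s : Finset ι) (R : ι → ℝ × ℝ) (x : ι → ℝ) :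
    lmarginal (fun _ => volume) s ((boxOn s R).indicator 1) x =
      ∏ i ∈ s, volume (interval (R i)) := by
  calc lmarginal (fun _ => volume) s ((boxOn s R).indicator 1) x
      = ∫⁻ y : s → ℝ, (Set.univ.pi fun i : s => interval (R i)).indicator 1 y := by
        refine lintegral_congr fun y => ?_
        by_cases hy : y ∈ Set.univ.pi fun i : s => interval (R i)
        · rw [Set.indicator_of_mem hy, Set.indicator_of_mem]
          · rfl
          · intro i hi
            simpa [Function.updateFinset, hi] using hy ⟨i, hi⟩ trivial
        · rw [Set.indicator_of_notMem hy, Set.indicator_of_notMem]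
          contrapose! hy
          intro i _
          simpa [Function.updateFinset] using hy i i.2
    _ = ∏ i : s, volume (interval (R i)) := by
        rw [lintegral_indicator_one (MeasurableSet.univ_pi fun i => measurableSet_interval _),
          volume_pi_pi]
    _ = _ := Finset.prod_coe_sort s fun i => volume (interval (R i))

/-- Averages over rectangles are controlled by the iterated maximal function. -/
lemma lmarginal_indicator_boxOn_le [DecidableEq ι] {𝓘 : Finset (ℝ × ℝ)} {R : ι → ℝ × ℝ}
    (hR : ∀ i, R i ∈ 𝓘) {φ : (ι → ℝ) → ℝ≥0∞} (hφ : Measurable φ) {l : List ι} (hl : l.Nodup)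
    {x : ι → ℝ} (hx : x ∈ boxOn l.toFinset R) :
    lmarginal (fun _ => volume) l.toFinset ((boxOn l.toFinset R).indicator φ) x ≤
      (∏ i ∈ l.toFinset, volume (interval (R i))) * iteratedMaximal 𝓘 l φ x := by
  induction l generalizing x with
  | nil =>
    simp only [List.toFinset_nil, lmarginal_empty, Finset.prod_empty, one_mul]
    exact Set.indicator_le_self' (fun _ _ => zero_le) _
  | cons i l ih =>
    obtain ⟨hil, hl⟩ := List.nodup_cons.1 hl
    have hi : i ∉ l.toFinset := by simpa using hil
    rw [List.toFinset_cons] at hx ⊢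
    have hxi : x i ∈ interval (R i) := hx i (Finset.mem_insert_self _ _)
    have hm := hφ.indicator (measurableSet_boxOn (insert i l.toFinset) R)
    rw [lmarginal_insert _ hm hi, Finset.prod_insert hi]
    set v := volume (interval (R i))
    have hv0 : v ≠ 0 := volume_interval_ne_zero hxi
    have hvt : v ≠ ∞ := volume_interval_ne_top (R i)
    set P := ∏ j ∈ l.toFinset, volume (interval (R j))
    have hT : Measurable (iteratedMaximal 𝓘 l φ) := hφ.iteratedMaximal l
    calc ∫⁻ y, lmarginal (fun _ => volume) l.toFinset
          ((boxOn (insert i l.toFinset) R).indicator φ) (Function.update x i y)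
        ≤ ∫⁻ y, (interval (R i)).indicator
            (fun y => P * iteratedMaximal 𝓘 l φ (Function.update x i y)) y := by
          refine lintegral_mono fun y => ?_
          by_cases hy : y ∈ interval (R i)
          · rw [Set.indicator_of_mem hy]
            refine le_trans (lmarginal_mono ?_ _) (ih hl ?_)
            · intro z
              have hsub : boxOn (insert i l.toFinset) R ⊆ boxOn l.toFinset R :=
                fun w hw j hj => hw j (Finset.mem_insert_of_mem hj)
              exact Set.indicator_le_indicator_of_subset hsub (fun _ => zero_le) z
            · intro j hj
              have : j ≠ i := fun h => hi (h ▸ hj)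
              rw [Function.update_of_ne this]
              exact hx j (Finset.mem_insert_of_mem hj)
          · rw [Set.indicator_of_notMem hy]
            refine le_trans (lmarginal_le_lmarginal_of_forall (g := 0) (x' := x) ?_) (by simp [lmarginal])
            intro z z' hz _ _
            rw [Set.indicator_of_notMem]
            · exact zero_le
            · intro h
              have := h i (Finset.mem_insert_self _ _)
              rw [hz i hi, Function.update_self] at this
              exact hy this
      _ = P * ∫⁻ y in interval (R i), iteratedMaximal 𝓘 l φ (Function.update x i y) := by
          rw [lintegral_indicator (measurableSet_interval _)]
          exact lintegral_const_mul P (hT.comp (measurable_update x))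
      _ = v * P * (v⁻¹ *
            ∫⁻ y in interval (R i), iteratedMaximal 𝓘 l φ (Function.update x i y)) := by
          rw [mul_comm v P, mul_assoc, ← mul_assoc v, ENNReal.mul_inv_cancel hv0 hvt, one_mul]
      _ ≤ v * P * iteratedMaximal 𝓘 (i :: l) φ x := by
          gcongr
          exact average_le_axisMaximal _ (hR i) hxi

variable [Fintype ι]

lemma measurableSet_box (R : ι → ℝ × ℝ) : MeasurableSet (box R) :=
  boxOn_univ R ▸ measurableSet_boxOn _ _

lemma measurableSet_stretchedBox (i₀ : ι) (R : ι → ℝ × ℝ) :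
    MeasurableSet (stretchedBox i₀ R) := by
  have : stretchedBox i₀ R = {x | x i₀ ∈ tripleInterval (R i₀)} ∩
      ⋂ i, ⋂ (_ : i ≠ i₀), {x | x i ∈ interval (R i)} := by ext; simp [stretchedBox]
  rw [this]
  exact (measurable_pi_apply i₀ (measurableSet_tripleInterval _)).inter <|
    MeasurableSet.iInter fun i => MeasurableSet.iInter fun _ =>
      measurable_pi_apply i (measurableSet_interval (R i))

lemma measurableSet_biUnion_box (t : Finset (ι → ℝ × ℝ)) : MeasurableSet (⋃ R ∈ t, box R) :=
  Finset.measurableSet_biUnion _ fun R _ => measurableSet_box R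

lemma measurableSet_biUnion_stretchedBox (i₀ : ι) (t : Finset (ι → ℝ × ℝ)) :
    MeasurableSet (⋃ R ∈ t, stretchedBox i₀ R) :=
  Finset.measurableSet_biUnion _ fun R _ => measurableSet_stretchedBox i₀ R

lemma volume_box (R : ι → ℝ × ℝ) : volume (box R) = ∏ i, volume (interval (R i)) := by
  rw [box_eq_pi, volume_pi_pi]

lemma volume_box_ne_top (R : ι → ℝ × ℝ) : volume (box R) ≠ ∞ := by
  rw [volume_box]
  exact ENNReal.prod_ne_top fun i _ => volume_interval_ne_top _

lemma volume_box_ne_zero {R : ι → ℝ × ℝ} {x : ι → ℝ} (hx : x ∈ box R) : volume (box R) ≠ 0 := by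
  rw [volume_box]
  exact Finset.prod_ne_zero_iff.2 fun i _ => volume_interval_ne_zero (hx i)

lemma setLIntegral_box_le [DecidableEq ι] {𝓘 : Finset (ℝ × ℝ)} {R : ι → ℝ × ℝ}
    (hR : ∀ i, R i ∈ 𝓘) {φ : (ι → ℝ) → ℝ≥0∞} (hφ : Measurable φ) {x : ι → ℝ} (hx : x ∈ box R) :
    ∫⁻ z in box R, φ z ≤
      volume (box R) * iteratedMaximal 𝓘 (Finset.univ : Finset ι).toList φ x := by
  have := lmarginal_indicator_boxOn_le hR hφ (Finset.nodup_toList Finset.univ) (x := x)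
    (by rwa [Finset.toList_toFinset, boxOn_univ])
  rw [Finset.toList_toFinset, boxOn_univ] at this
  rwa [volume_box, ← lintegral_indicator (measurableSet_box R), volume_pi,
    lintegral_eq_lmarginal_univ x]

/-- The slicing step of the Córdoba–Fefferman argument. -/
lemma setLIntegral_box_le_two_mul_diff [DecidableEq ι] {𝓘 : Finset (ℝ × ℝ)} (i₀ : ι) {a : ι → ℝ × ℝ}
    (ha : ∀ i, a i ∈ 𝓘) {t : Finset (ι → ℝ × ℝ)}
    (hlen : ∀ b ∈ t, (a i₀).2 - (a i₀).1 ≤ (b i₀).2 - (b i₀).1)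
    (hat : 2 * volume (box a ∩ ⋃ b ∈ t, stretchedBox i₀ b) ≤ volume (box a))
    {φ : (ι → ℝ) → ℝ≥0∞} (hφ : Measurable φ) :
    ∫⁻ x in box a, φ x ≤ 2 * ∫⁻ x in box a \ ⋃ b ∈ t, box b,
      iteratedMaximal 𝓘 (Finset.univ.erase i₀).toList φ x := by
  rcases (box a).eq_empty_or_nonempty with he | ⟨x₀, hx₀⟩
  · simp [he]
  set s := Finset.univ.erase i₀ with hs
  have hi₀ : i₀ ∉ s := Finset.notMem_erase _ _
  have hmem {i : ι} (hi : i ∉ s) : i = i₀ := by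
    by_contra h
    exact hi (Finset.mem_erase.2 ⟨h, Finset.mem_univ _⟩)
  set T := iteratedMaximal 𝓘 s.toList φ with hTdef
  have hT : Measurable T := hφ.iteratedMaximal _
  set Ω := ⋃ b ∈ t, box b with hΩ
  have hΩm : MeasurableSet Ω := measurableSet_biUnion_box t
  have ham := measurableSet_box a
  set P := ∏ i ∈ s, volume (interval (a i)) with hP
  have hP0 : P ≠ 0 := Finset.prod_ne_zero_iff.2 fun i _ => volume_interval_ne_zero (hx₀ i)
  have hPt : P ≠ ∞ := ENNReal.prod_ne_top fun i _ => volume_interval_ne_top _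
  set v := volume (interval (a i₀)) with hv
  have hv0 : v ≠ 0 := volume_interval_ne_zero (hx₀ i₀)
  have hvt : v ≠ ∞ := volume_interval_ne_top _
  have hvol : volume (box a) = v * P := by
    rw [volume_box, hP, hv, hs]
    exact (Finset.mul_prod_erase Finset.univ (fun i => volume (interval (a i)))
      (Finset.mem_univ i₀)).symm
  rw [← lintegral_indicator ham, ← lintegral_indicator (ham.diff hΩm),
    ← lintegral_const_mul _ (hT.indicator (ham.diff hΩm))]
  refine lintegral_le_of_lmarginal_le (μ := fun _ : ι => volume) s (hφ.indicator ham)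
    ((hT.indicator (ham.diff hΩm)).const_mul 2) fun x => ?_
  rw [lmarginal_const_mul' (hT.indicator (ham.diff hΩm))]
  by_cases hx : x i₀ ∈ interval (a i₀)
  swap
  · refine le_trans (lmarginal_le_lmarginal_of_forall (g := 0) (x' := x) ?_) (by simp [lmarginal])
    intro z z' hz _ _
    rw [Set.indicator_of_notMem]
    · exact zero_le
    · intro h
      exact hx (hz i₀ hi₀ ▸ h i₀)
  -- On the slice at height x i₀: W and U are the measures of the parts of `box a` outside and
  -- inside the earlier boxes, and m is the integral of φ over the whole slice.
  set W := lmarginal (fun _ => volume) s ((box a \ Ω).indicator 1) x with hW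
  set U := lmarginal (fun _ => volume) s ((box a ∩ Ω).indicator 1) x with hU
  set m := lmarginal (fun _ => volume) s ((box a).indicator φ) x with hm
  have hPWU : P ≤ W + U := by
    calc P = lmarginal (fun _ => volume) s ((boxOn s a).indicator 1) x :=
          (lmarginal_indicator_boxOn s a x).symm
      _ ≤ lmarginal (fun _ => volume) s
          (fun z => (box a \ Ω).indicator 1 z + (box a ∩ Ω).indicator 1 z) x := by
          refine lmarginal_le_lmarginal_of_forall fun z z' hz hz' hzz => ?_
          obtain rfl : z = z' := by
            ext i
            by_cases hi : i ∈ s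
            · exact hzz i hi
            · rw [hz i hi, hz' i hi]
          by_cases h : z ∈ boxOn s a
          · have hza : z ∈ box a := by
              intro i
              by_cases hi : i ∈ s
              · exact h i hi
              · obtain rfl := hmem hi
                rwa [hz i hi]
            by_cases hzΩ : z ∈ Ω <;> simp [h, hza, hzΩ]
          · simp [h]
      _ = W + U := by
          rw [hW, hU]
          exact lintegral_add_left
            ((measurable_one.indicator (ham.diff hΩm)).comp measurable_updateFinset) _
  have hUP : 2 * U ≤ P := by
    -- An earlier box is at least as long as a in direction i₀. If it meets a, its stretching
    -- contains the whole i₀-side of a. The slice measured by U thus reappears at every height of a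
    -- inside the stretched boxes.
    have h1 : v * U ≤ volume (box a ∩ ⋃ b ∈ t, stretchedBox i₀ b) := by
      have hsm := ham.inter (measurableSet_biUnion_stretchedBox i₀ t)
      rw [← lintegral_indicator_one hsm, volume_pi, lintegral_eq_lmarginal_univ x,
        ← Finset.insert_erase (Finset.mem_univ i₀), ← hs,
        lmarginal_insert _ (measurable_one.indicator hsm) hi₀, mul_comm, hv,
        ← setLIntegral_const]
      refine le_trans ?_ (setLIntegral_le_lintegral (interval (a i₀)) _)
      refine setLIntegral_mono' (measurableSet_interval _) fun y hy => ?_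
      refine lmarginal_le_lmarginal_of_forall fun z z' hz hz' hzz => ?_
      by_cases h : z ∈ box a ∩ Ω
      · rw [Set.indicator_of_mem h, Set.indicator_of_mem]
        · rfl
        obtain ⟨hza, hzΩ⟩ := h
        obtain ⟨b, hb, hzb⟩ := Set.mem_iUnion₂.1 hzΩ
        have hy' : z' i₀ = y := by rw [hz' i₀ hi₀, Function.update_self]
        have hns {i : ι} (hi : i ≠ i₀) : z i = z' i :=
          hzz i (Finset.mem_erase.2 ⟨hi, Finset.mem_univ _⟩)
        refine ⟨fun i => ?_, Set.mem_iUnion₂.2 ⟨b, hb, ?_, fun i hi => ?_⟩⟩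
        · by_cases hi : i = i₀
          · subst hi
            rwa [hy']
          · rw [← hns hi]
            exact hza i
        · rw [hy']
          exact interval_subset_tripleInterval_of_inter (hlen b hb) ⟨z i₀, hza i₀, hzb i₀⟩ hy
        · rw [← hns hi]
          exact hzb i
      · rw [Set.indicator_of_notMem h]
        exact zero_le
    have h2 : v * (2 * U) ≤ v * P := by
      calc v * (2 * U) = 2 * (v * U) := by rw [mul_left_comm]
        _ ≤ 2 * volume (box a ∩ ⋃ b ∈ t, stretchedBox i₀ b) := by gcongr
        _ ≤ v * P := hvol ▸ hat
    exact (ENNReal.mul_le_mul_iff_right hv0 hvt).1 h2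
  have hPW : P ≤ 2 * W := by
    have : P + P ≤ 2 * W + P := by
      calc P + P = 2 * P := (two_mul P).symm
        _ ≤ 2 * (W + U) := by gcongr
        _ = 2 * W + 2 * U := mul_add _ _ _
        _ ≤ 2 * W + P := by gcongr
    exact (ENNReal.add_le_add_iff_right hPt).1 this
  -- At every point of the slice outside Ω, the iterated maximal function dominates the slice
  -- average m / P. Integrating over those points gives m W, and W ≥ P / 2.
  have hmT : m * W ≤ P * lmarginal (fun _ => volume) s ((box a \ Ω).indicator T) x := by
    rw [hW, ← lmarginal_const_mul' (measurable_one.indicator (ham.diff hΩm)),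
      ← lmarginal_const_mul' (hT.indicator (ham.diff hΩm))]
    refine lmarginal_le_lmarginal_of_forall fun z z' hz hz' hzz => ?_
    obtain rfl : z = z' := by
      ext i
      by_cases hi : i ∈ s
      · exact hzz i hi
      · rw [hz i hi, hz' i hi]
    by_cases h : z ∈ box a \ Ω
    · rw [Set.indicator_of_mem h, Set.indicator_of_mem h, Pi.one_apply, mul_one]
      have := lmarginal_indicator_boxOn_le ha hφ s.nodup_toList (x := z)
        (fun i _ => h.1 i)
      rw [Finset.toList_toFinset] at this
      refine le_trans ?_ this
      rw [hm, lmarginal_congr (x := x) (y := z) _ _ fun i hi => (hz i hi).symm]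
      refine lmarginal_mono ?_ _
      have hsub : box a ⊆ boxOn s a := fun w hw j _ => hw j
      exact fun w => Set.indicator_le_indicator_of_subset hsub (fun _ => zero_le) w
    · rw [Set.indicator_of_notMem h, mul_zero]
      exact zero_le
  have : P * m ≤ P * (2 * lmarginal (fun _ => volume) s ((box a \ Ω).indicator T) x) := by
    calc P * m ≤ 2 * W * m := by gcongr
      _ = 2 * (m * W) := by rw [mul_assoc, mul_comm W]
      _ ≤ 2 * (P * lmarginal (fun _ => volume) s ((box a \ Ω).indicator T) x) := by gcongr
      _ = _ := by rw [mul_left_comm]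
  exact (ENNReal.mul_le_mul_iff_right hP0 hPt).1 this

/-- The Córdoba–Fefferman selection. -/
lemma exists_subset_box_selection [DecidableEq ι] (i₀ : ι) (𝓘 : Finset (ℝ × ℝ)) (s : Finset (ι → ℝ × ℝ))
    (hs : ∀ R ∈ s, ∀ i, R i ∈ 𝓘) :
    ∃ t ⊆ s, (∀ R ∈ s, volume (box R) ≤ 2 * volume (box R ∩ ⋃ b ∈ t, stretchedBox i₀ b)) ∧
      ∀ φ : (ι → ℝ) → ℝ≥0∞, Measurable φ → ∑ R ∈ t, ∫⁻ x in box R, φ x ≤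
        2 * ∫⁻ x in ⋃ R ∈ t, box R, iteratedMaximal 𝓘 (Finset.univ.erase i₀).toList φ x := by
  classical
  -- Boxes are examined by decreasing side in direction i₀, and a box is dropped when at least half
  -- of it is covered by the stretched boxes already kept.
  induction s using Finset.induction_on_min_value
    (fun R : ι → ℝ × ℝ => (R i₀).2 - (R i₀).1) with
  | empty => exact ⟨∅, by simp⟩
  | insert a s ha hmin ih =>
    obtain ⟨t, hts, hc, hsum⟩ := ih fun R hR => hs R (Finset.mem_insert_of_mem hR)
    by_cases hat : volume (box a) ≤ 2 * volume (box a ∩ ⋃ b ∈ t, stretchedBox i₀ b)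
    · refine ⟨t, hts.trans (Finset.subset_insert _ _), fun R hR => ?_, hsum⟩
      rcases Finset.mem_insert.1 hR with rfl | hR
      · exact hat
      · exact hc R hR
    · refine ⟨insert a t, Finset.insert_subset_insert _ hts, fun R hR => ?_, fun φ hφ => ?_⟩
      · rcases Finset.mem_insert.1 hR with rfl | hR
        · rw [Set.inter_eq_left.2]
          · exact le_mul_of_one_le_left zero_le (by norm_num)
          · exact (box_subset_stretchedBox i₀ R).trans
              (Set.subset_biUnion_of_mem (u := stretchedBox i₀) (Finset.mem_insert_self _ _))
        · refine (hc R hR).trans ?_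
          have hsub : (⋃ b ∈ t, stretchedBox i₀ b) ⊆ ⋃ b ∈ insert a t, stretchedBox i₀ b :=
            Set.biUnion_subset_biUnion_left (Finset.subset_insert a t)
          exact mul_le_mul_right (measure_mono (Set.inter_subset_inter_right _ hsub)) 2
      · have hat' : a ∉ t := fun h => ha (hts h)
        have h1 := setLIntegral_box_le_two_mul_diff i₀ (hs a (Finset.mem_insert_self _ _))
          (fun b hb => hmin b (hts hb)) (not_le.1 hat).le hφ
        rw [Finset.sum_insert hat']
        -- The new box is charged only to its part outside the earlier union, so the charged regions
        -- are disjoint and their integrals add up.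
        refine (add_le_add h1 (hsum φ hφ)).trans ?_
        rw [← mul_add, ← lintegral_union (measurableSet_biUnion_box t) Set.disjoint_sdiff_left,
          Set.sdiff_union_self]
        rw [Finset.set_biUnion_insert]

/-- On the line in direction i₀ through a point of a stretched box, the indicator of the union of
the boxes has average at least 1/3 > 1/4 over the tripled side. The weak type bound at level 1/4
costs 4 · 3 = 12. -/
lemma volume_biUnion_stretchedBox_le (i₀ : ι) (t : Finset (ι → ℝ × ℝ)) :
    volume (⋃ R ∈ t, stretchedBox i₀ R) ≤ 12 * volume (⋃ R ∈ t, box R) := by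
  classical
  set Ω := ⋃ R ∈ t, box R with hΩ
  have hΩm : MeasurableSet Ω := measurableSet_biUnion_box t
  set 𝓘 : Finset (ℝ × ℝ) :=
    t.image fun R => (2 * (R i₀).1 - (R i₀).2, 2 * (R i₀).2 - (R i₀).1) with h𝓘
  have key := mul_volume_axisMaximal_le 𝓘 i₀ (measurable_one.indicator hΩm) (4⁻¹ : ℝ≥0∞)
  rw [lintegral_indicator_one hΩm] at key
  have hsub : (⋃ R ∈ t, stretchedBox i₀ R) ⊆
      {x | 4⁻¹ < axisMaximal 𝓘 i₀ (Ω.indicator 1) x} := by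
    refine Set.iUnion₂_subset fun R hR x hx => ?_
    refine lt_axisMaximal_iff.2 ⟨_, Finset.mem_image_of_mem _ hR, hx.1, ?_⟩
    change 4⁻¹ < (volume (tripleInterval (R i₀)))⁻¹ * ∫⁻ y in tripleInterval (R i₀), _
    have h0 : (R i₀).1 < (R i₀).2 := by
      have := hx.1.1.trans hx.1.2
      linarith
    set v := volume (interval (R i₀)) with hv
    have hv0 : v ≠ 0 := by simpa [hv, volume_interval] using h0
    have hvt : v ≠ ∞ := volume_interval_ne_top _
    have h1 : v ≤ ∫⁻ y in tripleInterval (R i₀), Ω.indicator 1 (Function.update x i₀ y) := by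
      calc v = ∫⁻ y in interval (R i₀), 1 := by simp [hv]
        _ ≤ ∫⁻ y in interval (R i₀), Ω.indicator 1 (Function.update x i₀ y) := by
            refine setLIntegral_mono' (measurableSet_interval _) fun y hy => ?_
            rw [Set.indicator_of_mem]
            · rfl
            · refine Set.mem_biUnion hR fun i => ?_
              by_cases hi : i = i₀
              · subst hi
                rwa [Function.update_self]
              · rw [Function.update_of_ne hi]
                exact hx.2 i hi
        _ ≤ _ := lintegral_mono_set (interval_subset_tripleInterval _)
    calc (4⁻¹ : ℝ≥0∞) < 3⁻¹ := by
          rw [ENNReal.inv_lt_inv]; norm_num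
      _ = (3 * v)⁻¹ * v := by
          rw [ENNReal.mul_inv (by norm_num) (by norm_num), mul_assoc,
            ENNReal.inv_mul_cancel hv0 hvt, mul_one]
      _ ≤ _ := by
          rw [volume_tripleInterval]
          gcongr
  calc volume (⋃ R ∈ t, stretchedBox i₀ R)
      = 4 * (4⁻¹ * volume (⋃ R ∈ t, stretchedBox i₀ R)) := by
        rw [← mul_assoc, ENNReal.mul_inv_cancel (by norm_num) (by norm_num), one_mul]
    _ ≤ 4 * (3 * volume Ω) := by
        exact mul_le_mul_right ((mul_le_mul_right (measure_mono hsub) _).trans key) 4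
    _ = 12 * volume Ω := by
        rw [← mul_assoc]; norm_num

/-- Each R is at least half filled by A, so 4 · 1_A has average at least 2 over R and its iterated
maximal function is at least 2 there. The value 2 exceeds the threshold 1 below which `dyadicGrowth`
vanishes; since it also vanishes at 0, the final integral lives on A. -/
lemma volume_biUnion_box_le {𝓘 : Finset (ℝ × ℝ)} {s : Finset (ι → ℝ × ℝ)}
    (hs : ∀ R ∈ s, ∀ i, R i ∈ 𝓘) {A : Set (ι → ℝ)} (hA : MeasurableSet A)
    (h : ∀ R ∈ s, volume (box R) ≤ 2 * volume (box R ∩ A)) :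
    volume (⋃ R ∈ s, box R) ≤
      6 ^ Fintype.card ι * dyadicGrowth (Fintype.card ι) (2 ^ Fintype.card ι * 4) * volume A := by
  classical
  set N := Fintype.card ι
  set l := (Finset.univ : Finset ι).toList with hl
  have hlen : l.length = N := by simp [hl, N]
  set φ : (ι → ℝ) → ℝ≥0∞ := A.indicator fun _ => 4 with hφdef
  have hφ : Measurable φ := measurable_const.indicator hA
  have h1 : ∀ x ∈ ⋃ R ∈ s, box R, 1 ≤ dyadicGrowth 0 (iteratedMaximal 𝓘 l φ x) := by
    intro x hx
    obtain ⟨R, hR, hx⟩ := Set.mem_iUnion₂.1 hx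
    have h2 := setLIntegral_box_le (hs R hR) hφ hx
    rw [hφdef, lintegral_indicator_const hA, Measure.restrict_apply hA, Set.inter_comm] at h2
    have h3 : volume (box R) * 2 ≤ volume (box R) * iteratedMaximal 𝓘 l φ x := by
      refine le_trans ?_ h2
      calc volume (box R) * 2 ≤ 2 * volume (box R ∩ A) * 2 := by
            gcongr
            exact h R hR
        _ = 4 * volume (box R ∩ A) := by ring
    have h4 := (ENNReal.mul_le_mul_iff_right (volume_box_ne_zero hx) (volume_box_ne_top R)).1 h3
    have h5 := h4.trans (le_dyadicGrowth_zero_add_one _)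
    rw [← one_add_one_eq_two] at h5
    exact (ENNReal.add_le_add_iff_left ENNReal.one_ne_top).1 h5
  calc volume (⋃ R ∈ s, box R) = ∫⁻ x in ⋃ R ∈ s, box R, 1 := by simp
    _ ≤ ∫⁻ x in ⋃ R ∈ s, box R, dyadicGrowth 0 (iteratedMaximal 𝓘 l φ x) :=
        setLIntegral_mono' (measurableSet_biUnion_box s) h1
    _ ≤ ∫⁻ x, dyadicGrowth 0 (iteratedMaximal 𝓘 l φ x) := setLIntegral_le_lintegral _ _
    _ ≤ 6 ^ N * ∫⁻ x, dyadicGrowth N (2 ^ N * φ x) := by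
        have := lintegral_dyadicGrowth_iteratedMaximal_le 𝓘 l hφ 0
        rwa [hlen, zero_add] at this
    _ = 6 ^ N * ∫⁻ x, A.indicator (fun _ => dyadicGrowth N (2 ^ N * 4)) x := by
        congr 1
        refine lintegral_congr fun x => ?_
        by_cases hx : x ∈ A
        · simp [hφdef, hx]
        · simp [hφdef, hx, dyadicGrowth_zero_right]
    _ = _ := by
        rw [lintegral_indicator_const hA, mul_assoc]

/-- A Córdoba–Fefferman covering theorem for finite families of rectangles. -/
theorem exists_subset_box_covering [Nonempty ι] (s : Finset (ι → ℝ × ℝ)) :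
    ∃ t ⊆ s, volume (⋃ R ∈ s, box R) ≤ 12 * (6 ^ Fintype.card ι *
        dyadicGrowth (Fintype.card ι) (2 ^ Fintype.card ι * 4)) * volume (⋃ R ∈ t, box R) ∧
      ∀ φ : (ι → ℝ) → ℝ≥0∞, Measurable φ → ∑ R ∈ t, ∫⁻ x in box R, φ x ≤
        2 * volume (⋃ R ∈ t, box R) + 2 * 6 ^ (Fintype.card ι - 1) *
          ∫⁻ x, dyadicGrowth (Fintype.card ι - 1) (2 ^ (Fintype.card ι - 1) * φ x) := by
  classical
  obtain ⟨i₀⟩ := ‹Nonempty ι›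
  set 𝓘 : Finset (ℝ × ℝ) := s.biUnion fun R => Finset.univ.image R with h𝓘
  have hs : ∀ R ∈ s, ∀ i, R i ∈ 𝓘 := fun R hR i =>
    Finset.mem_biUnion.2 ⟨R, hR, Finset.mem_image_of_mem _ (Finset.mem_univ _)⟩
  obtain ⟨t, hts, hc, hsum⟩ := exists_subset_box_selection i₀ 𝓘 s hs
  refine ⟨t, hts, ?_, fun φ hφ => ?_⟩
  · refine (volume_biUnion_box_le hs (measurableSet_biUnion_stretchedBox i₀ t) hc).trans ?_
    rw [mul_comm 12, mul_assoc _ 12]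
    gcongr
    exact volume_biUnion_stretchedBox_le i₀ t
  -- The slicing direction i₀ needs no maximal function, so only n - 1 logarithms are spent, exactly
  -- the power in `Phi n`.
  · set l := (Finset.univ.erase i₀).toList with hl
    have hlen : l.length = Fintype.card ι - 1 := by simp [hl]
    have hW := lintegral_dyadicGrowth_iteratedMaximal_le 𝓘 l hφ 0
    rw [hlen, zero_add] at hW
    refine (hsum φ hφ).trans ?_
    rw [mul_assoc, ← mul_add]
    gcongr
    calc ∫⁻ x in ⋃ R ∈ t, box R, iteratedMaximal 𝓘 l φ x
        ≤ ∫⁻ x in ⋃ R ∈ t, box R, (1 + dyadicGrowth 0 (iteratedMaximal 𝓘 l φ x)) :=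
          lintegral_mono fun x => le_dyadicGrowth_zero_add_one _
      _ = volume (⋃ R ∈ t, box R) +
            ∫⁻ x in ⋃ R ∈ t, box R, dyadicGrowth 0 (iteratedMaximal 𝓘 l φ x) := by
          rw [lintegral_add_left measurable_const]
          simp
      _ ≤ _ := by
          gcongr
          exact (setLIntegral_le_lintegral _ _).trans hW

end Boxes

/-! ### Scalar inequalities for Φ and its dual. -/

section Scalar

open Real

lemma one_add_add_pow_le {a b : ℝ} (ha : 0 ≤ a) (hb : 0 ≤ b) (k : ℕ) :
    1 + (a + b) ^ k ≤ 2 ^ k * (1 + a ^ k) * (1 + b ^ k) := by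
  have h1 : (a + b) ^ k ≤ 2 ^ k * (a ^ k + b ^ k) := by
    refine (add_pow_le ha hb k).trans ?_
    gcongr
    · norm_num
    · omega
  have h2 : (1 : ℝ) ≤ 2 ^ k := one_le_pow₀ (by norm_num)
  have h3 : 0 ≤ a ^ k := by positivity
  have h4 : 0 ≤ b ^ k := by positivity
  have h5 : 0 ≤ 2 ^ k * (a ^ k * b ^ k) := by positivity
  linarith

lemma self_le_Phi (n : ℕ) {t : ℝ} (ht : 0 ≤ t) : t ≤ Phi n t :=
  le_mul_of_one_le_right ht (le_add_of_nonneg_right (pow_nonneg posLog_nonneg _))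

lemma Phi_nonneg (n : ℕ) {t : ℝ} (ht : 0 ≤ t) : 0 ≤ Phi n t := ht.trans (self_le_Phi n ht)

lemma measurable_Phi (n : ℕ) : Measurable (Phi n) := by
  have : Measurable Real.posLog := measurable_const.max Real.measurable_log
  exact measurable_id.mul (measurable_const.add (this.pow_const _))

/-- Submultiplicativity of Φ up to a constant, from log⁺(st) ≤ log⁺ s + log⁺ t; it takes the place
of homogeneity when functions are rescaled. -/
lemma Phi_mul_le (n : ℕ) {s t : ℝ} (hs : 0 ≤ s) (ht : 0 ≤ t) :
    Phi n (s * t) ≤ 2 ^ (n - 1) * Phi n s * Phi n t := by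
  unfold Phi
  calc s * t * (1 + log⁺ (s * t) ^ (n - 1))
      ≤ s * t * (1 + (log⁺ s + log⁺ t) ^ (n - 1)) := by
        gcongr
        · exact posLog_nonneg
        · exact posLog_mul
    _ ≤ s * t * (2 ^ (n - 1) * (1 + log⁺ s ^ (n - 1)) * (1 + log⁺ t ^ (n - 1))) := by
        gcongr
        exact one_add_add_pow_le posLog_nonneg posLog_nonneg _
    _ = _ := by ring

/-- The dual function `x (1 + (log⁺ x⁻¹) ^ (n - 1))` of `Phi n`. -/
noncomputable def dualPhi (n : ℕ) (x : ℝ) : ℝ := x * (1 + log⁺ x⁻¹ ^ (n - 1))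

lemma self_le_dualPhi (n : ℕ) {x : ℝ} (hx : 0 ≤ x) : x ≤ dualPhi n x :=
  le_mul_of_one_le_right hx (le_add_of_nonneg_right (pow_nonneg posLog_nonneg _))

/-- Since y ≤ `dualPhi n y`, the logarithm of the inverse of `dualPhi n y` is at most that of y⁻¹.
This makes `dualPhi n y` the right scale by which to divide a function whose Φ has average y. -/
lemma Phi_inv_dualPhi_mul_le (n : ℕ) {y : ℝ} (hy : 0 < y) :
    Phi n (dualPhi n y)⁻¹ * y ≤ 1 := by
  have h1 := self_le_dualPhi n hy.le
  have h0 : 0 < dualPhi n y := hy.trans_le h1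
  have h2 : log⁺ (dualPhi n y)⁻¹ ≤ log⁺ y⁻¹ :=
    posLog_le_posLog (by positivity) (inv_anti₀ hy h1)
  have h3 : 0 ≤ log⁺ (dualPhi n y)⁻¹ := posLog_nonneg
  calc Phi n (dualPhi n y)⁻¹ * y
      = (dualPhi n y)⁻¹ * (y * (1 + log⁺ (dualPhi n y)⁻¹ ^ (n - 1))) := by unfold Phi; ring
    _ ≤ (dualPhi n y)⁻¹ * (y * (1 + log⁺ y⁻¹ ^ (n - 1))) := by gcongr
    _ = 1 := inv_mul_cancel₀ h0.ne'

/-- One term of the exponential series at (log z) / 2. -/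
lemma posLog_pow_le (k : ℕ) {z : ℝ} (hz : 1 ≤ z) : log⁺ z ^ k ≤ 2 ^ k * k.factorial * √z := by
  have h0 : 0 < z := by linarith
  have h1 : log⁺ z = log z := posLog_eq_log (by rwa [abs_of_pos h0])
  have h2 := pow_div_factorial_le_exp (log z / 2) (by have := log_nonneg hz; positivity) k
  have h3 : exp (log z / 2) = √z := by
    rw [sqrt_eq_rpow, rpow_def_of_pos h0]; congr 1; ring
  rw [h3, div_le_iff₀ (by positivity), div_pow, div_le_iff₀ (by positivity)] at h2
  rw [h1]
  linarith

lemma dualPhi_le_of_le_one (n : ℕ) {x : ℝ} (hx : 0 < x) (hx1 : x ≤ 1) :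
    dualPhi n x ≤ (1 + 2 ^ (n - 1) * (n - 1).factorial) * √x := by
  have h1 := posLog_pow_le (n - 1) (one_le_inv_iff₀.2 ⟨hx, hx1⟩)
  have h2 : 0 < √x := sqrt_pos.2 hx
  have h3 : √x ≤ 1 := sqrt_le_one.2 hx1
  have h4 : √x * √x = x := mul_self_sqrt hx.le
  rw [sqrt_inv] at h1
  calc dualPhi n x ≤ x * (1 + 2 ^ (n - 1) * (n - 1).factorial * (√x)⁻¹) := by
        unfold dualPhi; gcongr
    _ = x + 2 ^ (n - 1) * (n - 1).factorial * (x * (√x)⁻¹) := by ring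
    _ = √x * √x + 2 ^ (n - 1) * (n - 1).factorial * √x := by
        rw [h4, ← div_eq_mul_inv x, div_sqrt]
    _ ≤ _ := by nlinarith

lemma dualPhi_le_two_mul (n : ℕ) {x : ℝ} (hx : 1 ≤ x) : dualPhi n x ≤ 2 * x := by
  have h1 : log⁺ x⁻¹ = 0 := by
    rw [posLog_eq_zero_iff, abs_of_pos (by positivity)]
    exact inv_le_one_of_one_le₀ hx
  have h2 : (0 : ℝ) ^ (n - 1) ≤ 1 := pow_le_one₀ le_rfl zero_le_one
  unfold dualPhi
  rw [h1]
  nlinarith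

/-- Since `dualPhi n x` is O(√x) for x ≤ 1, the hypothesis prevents x from being much smaller than
y⁻² when y ≥ 1. Then log x⁻¹ is at most a constant plus 2 log y, and the logarithm in `dualPhi n x`
is absorbed by the one in `Phi n y`. When y ≤ 1 as well, both x and y are bounded below. -/
lemma exists_le_Phi_mul_Phi_of_le_one (n : ℕ) {c : ℝ} (hc : 0 < c) :
    ∃ c' > 0, ∀ x y : ℝ, 0 < x → x ≤ 1 → 0 < y → c ≤ dualPhi n x * dualPhi n y →
      c' ≤ Phi n x * Phi n y := by
  set k := n - 1 with hk
  set B : ℝ := 1 + 2 ^ k * k.factorial with hB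
  have hB2 : 2 ≤ B := by
    have h1 : (1 : ℝ) ≤ 2 ^ k := one_le_pow₀ (by norm_num)
    have h2 : (1 : ℝ) ≤ k.factorial := by exact_mod_cast k.factorial_pos
    nlinarith
  have hinv {x m : ℝ} (hx : 0 < x) (hx1 : x ≤ 1) (hm : 0 < m) {F : ℝ} (hF : F ≤ B * m)
      (h : c ≤ dualPhi n x * F) : x⁻¹ ≤ (B ^ 2 / c * m) ^ 2 := by
    have h1 := dualPhi_le_of_le_one n hx hx1
    have h2 : 0 < √x := sqrt_pos.2 hx
    have h5 : 0 < dualPhi n x := hx.trans_le (self_le_dualPhi n hx.le)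
    have h3 : c ≤ B ^ 2 * m * √x := by
      calc c ≤ dualPhi n x * F := h
        _ ≤ dualPhi n x * (B * m) := by gcongr
        _ ≤ (B * √x) * (B * m) := by gcongr
        _ = _ := by ring
    have h4 : (√x)⁻¹ ≤ B ^ 2 / c * m := by
      rw [inv_le_iff_one_le_mul₀ h2]
      calc (1 : ℝ) = c / c := (div_self hc.ne').symm
        _ ≤ B ^ 2 * m * √x / c := by gcongr
        _ = _ := by ring
    calc x⁻¹ = ((√x)⁻¹) ^ 2 := by rw [inv_pow, sq_sqrt hx.le]
      _ ≤ _ := by gcongr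
  set D : ℝ := log⁺ ((B ^ 2 / c) ^ 2) with hD
  have hD0 : 0 ≤ D := posLog_nonneg
  set E : ℝ := 2 * (2 ^ k * (1 + D ^ k) * 2 ^ k) with hE
  have hE0 : 0 < E := by positivity
  refine ⟨min (c / E) ((c / B ^ 2) ^ 4), by positivity, fun x y hx hx1 hy h => ?_⟩
  have hPx := self_le_Phi n hx.le
  have hPy := self_le_Phi n hy.le
  rcases le_total 1 y with hy1 | hy1
  · refine (min_le_left _ _).trans ?_
    have hF := dualPhi_le_two_mul n hy1
    have h1 := hinv hx hx1 hy (hF.trans (by gcongr)) h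
    have h2 : log⁺ x⁻¹ ≤ D + 2 * log⁺ y := by
      calc log⁺ x⁻¹ ≤ log⁺ ((B ^ 2 / c) ^ 2 * (y * y)) :=
            posLog_le_posLog (by positivity) (h1.trans_eq (by ring))
        _ ≤ D + log⁺ (y * y) := posLog_mul
        _ ≤ D + (log⁺ y + log⁺ y) := by gcongr; exact posLog_mul
        _ = _ := by ring
    have hL : 0 ≤ log⁺ y := posLog_nonneg
    have hLx : 0 ≤ log⁺ x⁻¹ := posLog_nonneg
    have h3 : 1 + log⁺ x⁻¹ ^ k ≤ 2 ^ k * (1 + D ^ k) * 2 ^ k * (1 + log⁺ y ^ k) := by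
      calc 1 + log⁺ x⁻¹ ^ k ≤ 1 + (D + 2 * log⁺ y) ^ k := by gcongr
        _ ≤ 2 ^ k * (1 + D ^ k) * (1 + (2 * log⁺ y) ^ k) :=
            one_add_add_pow_le hD0 (by positivity) k
        _ ≤ 2 ^ k * (1 + D ^ k) * (2 ^ k * (1 + log⁺ y ^ k)) := by
            gcongr
            have : (1 : ℝ) ≤ 2 ^ k := one_le_pow₀ (by norm_num)
            rw [mul_pow, mul_add]
            linarith
        _ = _ := by ring
    rw [div_le_iff₀ hE0]
    calc c ≤ dualPhi n x * dualPhi n y := h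
      _ ≤ dualPhi n x * (2 * y) := by
          have := self_le_dualPhi n hx.le
          gcongr
          linarith
      _ = 2 * x * y * (1 + log⁺ x⁻¹ ^ k) := by unfold dualPhi; ring
      _ ≤ 2 * x * y * (2 ^ k * (1 + D ^ k) * 2 ^ k * (1 + log⁺ y ^ k)) := by gcongr
      _ = x * Phi n y * E := by unfold Phi; ring
      _ ≤ Phi n x * Phi n y * E := by
          have := Phi_nonneg n hy.le
          gcongr
  · refine (min_le_right _ _).trans ?_
    have hF {z : ℝ} (hz : 0 < z) (hz1 : z ≤ 1) : dualPhi n z ≤ B * 1 := by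
      have := dualPhi_le_of_le_one n hz hz1
      refine this.trans ?_
      gcongr
      exact sqrt_le_one.2 hz1
    have h1 := hinv hx hx1 one_pos (hF hy hy1) h
    have h2 := hinv hy hy1 one_pos (hF hx hx1) (mul_comm (dualPhi n x) _ ▸ h)
    have h3 {z : ℝ} (hz : 0 < z) (hz1 : z⁻¹ ≤ (B ^ 2 / c * 1) ^ 2) : (c / B ^ 2) ^ 2 ≤ z := by
      have := inv_anti₀ (by positivity) hz1
      rwa [inv_inv, mul_one, ← inv_pow, inv_div] at this
    calc (c / B ^ 2) ^ 4 = (c / B ^ 2) ^ 2 * (c / B ^ 2) ^ 2 := by ring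
      _ ≤ x * y := by
          have := h3 hx h1
          have := h3 hy h2
          gcongr
      _ ≤ _ := mul_le_mul hPx hPy hy.le (Phi_nonneg n hx.le)

lemma exists_le_Phi_mul_Phi (n : ℕ) {c : ℝ} (hc : 0 < c) :
    ∃ c' > 0, ∀ x y : ℝ, 0 < x → 0 < y → c ≤ dualPhi n x * dualPhi n y →
      c' ≤ Phi n x * Phi n y := by
  obtain ⟨c', hc', h⟩ := exists_le_Phi_mul_Phi_of_le_one n hc
  refine ⟨min c' 1, by positivity, fun x y hx hy hxy => ?_⟩
  rcases le_total x 1 with hx1 | hx1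
  · exact (min_le_left _ _).trans (h x y hx hx1 hy hxy)
  rcases le_total y 1 with hy1 | hy1
  · rw [mul_comm] at hxy ⊢
    exact (min_le_left _ _).trans (h y x hy hy1 hx hxy)
  · refine (min_le_right _ _).trans ?_
    exact one_le_mul_of_one_le_of_one_le (hx1.trans (self_le_Phi n hx.le))
      (hy1.trans (self_le_Phi n hy.le))

/-- With 2^K < s the last nonzero level, the geometric sum is below 4s, and K ≤ 2 log s because log
2 > 1/2. -/
lemma dyadicGrowth_ofReal_le (k : ℕ) (s : ℝ) :
    dyadicGrowth k (ENNReal.ofReal s) ≤ ENNReal.ofReal (4 * s * (1 + 2 * log⁺ s) ^ k) := by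
  have h := exists_le_two_pow (t := ENNReal.ofReal s) ENNReal.ofReal_ne_top
  rw [dyadicGrowth_eq_sum h]
  rcases Nat.eq_zero_or_pos (Nat.find h) with h0 | h0
  · simp [h0]
  obtain ⟨K, hK⟩ := Nat.exists_eq_succ_of_ne_zero h0.ne'
  rw [hK]
  have h1 : (2 : ℝ) ^ K < s := by
    have := (two_pow_lt_iff_lt_find h K).2 (by omega)
    rw [show (2 : ℝ≥0∞) ^ K = ENNReal.ofReal (2 ^ K) by
      rw [ENNReal.ofReal_pow (by norm_num)]; simp] at this
    exact (ENNReal.ofReal_lt_ofReal_iff_of_nonneg (by positivity)).1 this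
  have h2 : (K : ℝ) + 1 ≤ 1 + 2 * log⁺ s := by
    have h3 : (K : ℝ) * log 2 ≤ log s := by
      rw [← log_pow]
      exact log_le_log (by positivity) h1.le
    have h4 : log s ≤ log⁺ s := le_max_right _ _
    have h5 := log_two_gt_d9
    have h6 : (0 : ℝ) ≤ K := by positivity
    nlinarith
  have h3 : ∑ m ∈ Finset.range (K + 1), (2 : ℝ) ^ (m + 1) ≤ 4 * s := by
    have : ∀ N : ℕ, ∑ m ∈ Finset.range N, (2 : ℝ) ^ (m + 1) = 2 * 2 ^ N - 2 := by
      intro N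
      induction N with
      | zero => simp
      | succ N ih => rw [Finset.sum_range_succ, ih]; ring
    rw [this, pow_succ]
    linarith
  have h4 : ∑ m ∈ Finset.range (K + 1), (2 : ℝ) ^ (m + 1) * ((m : ℝ) + 1) ^ k ≤
      4 * s * (1 + 2 * log⁺ s) ^ k := by
    have hL : 0 ≤ log⁺ s := posLog_nonneg
    calc ∑ m ∈ Finset.range (K + 1), (2 : ℝ) ^ (m + 1) * ((m : ℝ) + 1) ^ k
        ≤ ∑ m ∈ Finset.range (K + 1), (2 : ℝ) ^ (m + 1) * (1 + 2 * log⁺ s) ^ k := by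
          refine Finset.sum_le_sum fun m hm => ?_
          have : (m : ℝ) ≤ K := by exact_mod_cast Nat.lt_succ_iff.1 (Finset.mem_range.1 hm)
          gcongr _ * ?_ ^ k
          linarith
      _ = (∑ m ∈ Finset.range (K + 1), (2 : ℝ) ^ (m + 1)) * (1 + 2 * log⁺ s) ^ k :=
          (Finset.sum_mul _ _ _).symm
      _ ≤ _ := by gcongr
  refine le_trans (le_of_eq ?_) (ENNReal.ofReal_le_ofReal h4)
  rw [ENNReal.ofReal_sum_of_nonneg fun m _ => by positivity]
  refine Finset.sum_congr rfl fun m _ => ?_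
  rw [ENNReal.ofReal_mul (by positivity), ENNReal.ofReal_pow (by norm_num),
    ENNReal.ofReal_pow (by positivity), ENNReal.ofReal_add (by positivity) (by norm_num)]
  simp

lemma posLog_rpow {u q : ℝ} (hu : 0 ≤ u) (hq : 0 < q) : log⁺ (u ^ q) = q * log⁺ u := by
  rcases hu.eq_or_lt with rfl | hu
  · simp [zero_rpow hq.ne']
  · rw [posLog_apply, posLog_apply, log_rpow hu, mul_max_of_nonneg _ _ hq.le, mul_zero]

/-- The constant sits inside the q-th power and does not depend on q, which is the source of
uniformity in p. -/
lemma exists_dyadicGrowth_rpow_le (n : ℕ) :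
    ∃ C : ℝ, 1 ≤ C ∧ ∀ q : ℝ, 1 ≤ q → ∀ u : ℝ, 0 ≤ u →
      dyadicGrowth (n - 1) (2 ^ (n - 1) * ENNReal.ofReal (u ^ q)) ≤
        ENNReal.ofReal ((C * Phi n u) ^ q) := by
  set k := n - 1 with hk
  set D : ℝ := 4 * 8 ^ k * (1 + 2 * k) ^ k with hD
  have hD1 : 1 ≤ D := by
    have h1 : (1 : ℝ) ≤ 8 ^ k := one_le_pow₀ (by norm_num)
    have h2 : (1 : ℝ) ≤ (1 + 2 * k) ^ k := one_le_pow₀ (by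
      have : (0 : ℝ) ≤ k := by positivity
      linarith)
    nlinarith
  have hE1 : 1 ≤ exp k := one_le_exp (by positivity)
  refine ⟨D * exp k, one_le_mul_of_one_le_of_one_le hD1 hE1, fun q hq u hu => ?_⟩
  have hq0 : 0 < q := by linarith
  have hL : 0 ≤ log⁺ u := posLog_nonneg
  have huq : 0 ≤ u ^ q := by positivity
  rw [show (2 : ℝ≥0∞) ^ k * ENNReal.ofReal (u ^ q) = ENNReal.ofReal (2 ^ k * u ^ q) by
    rw [ENNReal.ofReal_mul (by positivity), ENNReal.ofReal_pow (by norm_num)]; simp]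
  refine (dyadicGrowth_ofReal_le k _).trans (ENNReal.ofReal_le_ofReal ?_)
  have h1 : log⁺ (2 ^ k * u ^ q) ≤ k + q * log⁺ u := by
    refine posLog_mul.trans ?_
    rw [posLog_rpow hu hq0]
    gcongr
    have h2 : (1 : ℝ) ≤ 2 ^ k := one_le_pow₀ (by norm_num)
    rw [posLog_eq_log (by rwa [abs_of_nonneg (by positivity)]), log_pow]
    have := log_two_lt_d9
    have h6 : (0 : ℝ) ≤ k := by positivity
    nlinarith
  have hL2 : 0 ≤ log⁺ (2 ^ k * u ^ q) := posLog_nonneg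
  have hqk : (1 : ℝ) ≤ (2 * q) ^ k := one_le_pow₀ (by linarith)
  have hkk : (1 : ℝ) ≤ (1 + 2 * k) ^ k := one_le_pow₀ (by
    have : (0 : ℝ) ≤ k := by positivity
    linarith)
  have h2 : (1 + 2 * log⁺ (2 ^ k * u ^ q)) ^ k ≤
      4 ^ k * (1 + 2 * k) ^ k * q ^ k * (1 + log⁺ u ^ k) := by
    calc (1 + 2 * log⁺ (2 ^ k * u ^ q)) ^ k ≤ ((1 + 2 * k) + 2 * q * log⁺ u) ^ k := by
          gcongr ?_ ^ k
          linarith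
      _ ≤ 2 ^ (k - 1) * ((1 + 2 * k) ^ k + (2 * q * log⁺ u) ^ k) :=
          add_pow_le (by positivity) (by positivity) k
      _ ≤ 2 ^ k * ((1 + 2 * k) ^ k * (2 * q) ^ k + (1 + 2 * k) ^ k * (2 * q) ^ k * log⁺ u ^ k) := by
          rw [mul_pow (2 * q)]
          gcongr
          · norm_num
          · omega
          · exact le_mul_of_one_le_right (by positivity) hqk
          · exact le_mul_of_one_le_left (by positivity) hkk
      _ = _ := by
          rw [show (4 : ℝ) = 2 * 2 by norm_num, mul_pow 2 2, mul_pow 2 q]; ring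
  -- The factor q^k coming from log⁺(u^q) = q log⁺ u is absorbed into a q-th power.
  have h3 : q ^ k ≤ exp k ^ q := by
    calc q ^ k ≤ exp q ^ k := by
          gcongr
          have := add_one_le_exp q
          linarith
      _ = exp k ^ q := by
          rw [← exp_nat_mul, ← exp_mul]
  have h4 : D ≤ D ^ q := by
    simpa using rpow_le_rpow_of_exponent_le hD1 hq
  have h5 : 1 + log⁺ u ^ k ≤ (1 + log⁺ u ^ k) ^ q := by
    have : 0 ≤ log⁺ u ^ k := by positivity
    simpa using rpow_le_rpow_of_exponent_le (by linarith : 1 ≤ 1 + log⁺ u ^ k) hq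
  calc 4 * (2 ^ k * u ^ q) * (1 + 2 * log⁺ (2 ^ k * u ^ q)) ^ k
      ≤ 4 * (2 ^ k * u ^ q) * (4 ^ k * (1 + 2 * k) ^ k * q ^ k * (1 + log⁺ u ^ k)) := by gcongr
    _ = D * q ^ k * (u ^ q * (1 + log⁺ u ^ k)) := by
        rw [hD, show (8 : ℝ) = 2 * 4 by norm_num, mul_pow 2 4]; ring
    _ ≤ D ^ q * exp k ^ q * (u ^ q * (1 + log⁺ u ^ k) ^ q) := by gcongr
    _ = _ := by
        rw [Phi, ← mul_rpow (by positivity) (by positivity), ← mul_rpow hu (by positivity),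
          ← mul_rpow (by positivity) (by positivity)]

end Scalar

/-! ### Overlap bounds and a Jensen type inequality for Φ. -/

section Integral

lemma Phi_mul_rpow_mul_le {n : ℕ} {A M u z h q : ℝ} (hA : 0 ≤ A) (hu : 0 ≤ u)
    (hz : 0 ≤ z) (hq : 0 ≤ q) (h0 : 0 ≤ h) (hM : A * 2 ^ (n - 1) ≤ M) (hzu : Phi n u * z ≤ 1) :
    (A * Phi n (u * h)) ^ q * z ^ q ≤ M ^ q * Phi n h ^ q := by
  have hP := Phi_nonneg n hu
  have hPh := Phi_nonneg n h0
  have hPuh := Phi_nonneg n (mul_nonneg hu h0)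
  rw [← Real.mul_rpow (by positivity) hz, ← Real.mul_rpow (le_trans (by positivity) hM) hPh]
  refine Real.rpow_le_rpow (by positivity) ?_ hq
  calc A * Phi n (u * h) * z ≤ A * (2 ^ (n - 1) * Phi n u * Phi n h) * z := by
        gcongr
        exact Phi_mul_le n hu h0
    _ = A * 2 ^ (n - 1) * Phi n h * (Phi n u * z) := by ring
    _ ≤ A * 2 ^ (n - 1) * Phi n h * 1 := by gcongr
    _ ≤ M * Phi n h := by
        rw [mul_one]
        gcongr

/-- The integrals of a `q`-th power over a selected family of rectangles. -/
lemma exists_sum_setLIntegral_rpow_box_le (n : ℕ) :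
    ∃ C : ℝ, 1 ≤ C ∧ ∀ q : ℝ, 1 ≤ q → ∀ h : (Fin n → ℝ) → ℝ, Measurable h → (∀ x, 0 ≤ h x) →
      ∀ t : Finset (Fin n → ℝ × ℝ),
      (∀ φ : (Fin n → ℝ) → ℝ≥0∞, Measurable φ → ∑ R ∈ t, ∫⁻ x in box R, φ x ≤
        2 * volume (⋃ R ∈ t, box R) + 2 * 6 ^ (n - 1) *
          ∫⁻ x, dyadicGrowth (n - 1) (2 ^ (n - 1) * φ x)) →
      ∀ y : ℝ, 0 < y →
      ∫⁻ x in ⋃ R ∈ t, box R, ENNReal.ofReal (Phi n (h x) ^ q) ≤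
        ENNReal.ofReal (y ^ q) * volume (⋃ R ∈ t, box R) →
      ∑ R ∈ t, ∫⁻ x in box R, ENNReal.ofReal (h x ^ q) ≤
        ENNReal.ofReal ((C * dualPhi n y) ^ q) * volume (⋃ R ∈ t, box R) := by
  obtain ⟨A, hA1, hA⟩ := exists_dyadicGrowth_rpow_le n
  set k := n - 1 with hk
  set M : ℝ := A * 2 ^ k with hM
  have h2k : (1 : ℝ) ≤ 2 ^ k := one_le_pow₀ (by norm_num)
  have h6k : (1 : ℝ) ≤ 6 ^ k := one_le_pow₀ (by norm_num)
  have hM1 : 1 ≤ M := one_le_mul_of_one_le_of_one_le hA1 h2k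
  refine ⟨(2 + 2 * 6 ^ k) * M, one_le_mul_of_one_le_of_one_le (by linarith) hM1, ?_⟩
  intro q hq h hh hh0 t hcov y hy hint
  have hq0 : 0 < q := by linarith
  set Ω := ⋃ R ∈ t, box R with hΩ
  have hΩm : MeasurableSet Ω := measurableSet_biUnion_box t
  set lam := dualPhi n y with hlam
  have hlam0 : 0 < lam := hy.trans_le (self_le_dualPhi n hy.le)
  -- Dividing by `lam` makes the growth integral of φ at most M^q |Ω|, comparable with the other
  -- term 2|Ω| of the covering bound.
  set φ : (Fin n → ℝ) → ℝ≥0∞ := Ω.indicator fun x => ENNReal.ofReal ((lam⁻¹ * h x) ^ q) with hφdef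
  have hpow : Measurable fun x => ENNReal.ofReal ((lam⁻¹ * h x) ^ q) :=
    ((hh.const_mul _).pow_const q).ennreal_ofReal
  have hφ : Measurable φ := hpow.indicator hΩm
  have hW : ∫⁻ x, dyadicGrowth k (2 ^ k * φ x) ≤ ENNReal.ofReal (M ^ q) * volume Ω := by
    have hyq : ENNReal.ofReal (y ^ q) ≠ 0 := by
      simpa using Real.rpow_pos_of_pos hy q
    refine (ENNReal.mul_le_mul_iff_left hyq ENNReal.ofReal_ne_top).1 ?_
    calc (∫⁻ x, dyadicGrowth k (2 ^ k * φ x)) * ENNReal.ofReal (y ^ q)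
        ≤ (∫⁻ x in Ω, ENNReal.ofReal ((A * Phi n (lam⁻¹ * h x)) ^ q)) *
            ENNReal.ofReal (y ^ q) := by
          refine mul_le_mul_left ?_ _
          rw [← lintegral_indicator hΩm]
          refine lintegral_mono fun x => ?_
          by_cases hx : x ∈ Ω
          · rw [hφdef, Set.indicator_of_mem hx, Set.indicator_of_mem hx]
            exact hA q hq _ (mul_nonneg (inv_nonneg.2 hlam0.le) (hh0 x))
          · rw [hφdef, Set.indicator_of_notMem hx, Set.indicator_of_notMem hx, mul_zero,
              dyadicGrowth_zero_right]
      _ = ∫⁻ x in Ω, ENNReal.ofReal ((A * Phi n (lam⁻¹ * h x)) ^ q * y ^ q) := by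
          rw [← lintegral_mul_const]
          · refine lintegral_congr fun x => ?_
            have := Phi_nonneg n (mul_nonneg (inv_nonneg.2 hlam0.le) (hh0 x))
            rw [← ENNReal.ofReal_mul (by positivity)]
          · exact ((((measurable_Phi n).comp (hh.const_mul _)).const_mul A).pow_const q).ennreal_ofReal
      _ ≤ ∫⁻ x in Ω, ENNReal.ofReal (M ^ q) * ENNReal.ofReal (Phi n (h x) ^ q) := by
          refine lintegral_mono fun x => ?_
          rw [← ENNReal.ofReal_mul (by positivity)]
          exact ENNReal.ofReal_le_ofReal <| Phi_mul_rpow_mul_le (by linarith)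
            (inv_nonneg.2 hlam0.le) hy.le hq0.le (hh0 x) le_rfl (Phi_inv_dualPhi_mul_le n hy)
      _ = ENNReal.ofReal (M ^ q) * ∫⁻ x in Ω, ENNReal.ofReal (Phi n (h x) ^ q) :=
          lintegral_const_mul _ (((measurable_Phi n).comp hh).pow_const q).ennreal_ofReal
      _ ≤ ENNReal.ofReal (M ^ q) * (ENNReal.ofReal (y ^ q) * volume Ω) := by gcongr
      _ = _ := by ring
  have hsum : ∑ R ∈ t, ∫⁻ x in box R, ENNReal.ofReal (h x ^ q) =
      ENNReal.ofReal (lam ^ q) * ∑ R ∈ t, ∫⁻ x in box R, φ x := by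
    rw [Finset.mul_sum]
    refine Finset.sum_congr rfl fun R hR => ?_
    rw [← lintegral_const_mul _ hφ]
    refine setLIntegral_congr_fun (measurableSet_box R) fun x hx => ?_
    have hxΩ : x ∈ Ω := Set.mem_biUnion hR hx
    simp only [hφdef, Set.indicator_of_mem hxΩ]
    have := hh0 x
    rw [← ENNReal.ofReal_mul (by positivity), ← Real.mul_rpow hlam0.le (by positivity),
      mul_inv_cancel_left₀ hlam0.ne']
  rw [hsum, Real.mul_rpow (by positivity) hlam0.le, ENNReal.ofReal_mul (by positivity),
    mul_comm (ENNReal.ofReal _) (ENNReal.ofReal _), mul_assoc]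
  gcongr
  calc ∑ R ∈ t, ∫⁻ x in box R, φ x
      ≤ 2 * volume Ω + 2 * 6 ^ k * (ENNReal.ofReal (M ^ q) * volume Ω) := by
        refine (hcov φ hφ).trans ?_
        gcongr
    _ = ENNReal.ofReal (2 + 2 * 6 ^ k * M ^ q) * volume Ω := by
        rw [ENNReal.ofReal_add (by norm_num) (by positivity), ENNReal.ofReal_mul (by positivity),
          ENNReal.ofReal_mul (by norm_num), ENNReal.ofReal_pow (by norm_num), add_mul, ← mul_assoc]
        norm_num
    _ ≤ _ := by
        refine mul_le_mul_left (ENNReal.ofReal_le_ofReal ?_) _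
        have h1 : (1 : ℝ) ≤ M ^ q := Real.one_le_rpow hM1 hq0.le
        have h2 : 2 + 2 * (6 : ℝ) ^ k ≤ (2 + 2 * 6 ^ k) ^ q := by
          simpa using Real.rpow_le_rpow_of_exponent_le
            (by linarith : (1 : ℝ) ≤ 2 + 2 * 6 ^ k) hq
        rw [Real.mul_rpow (x := 2 + 2 * 6 ^ k) (y := M) (by positivity) (by linarith)]
        calc 2 + 2 * 6 ^ k * M ^ q ≤ (2 + 2 * 6 ^ k) * M ^ q := by linarith
          _ ≤ _ := by gcongr

/-- A Jensen type inequality for `t ↦ Phi n (t ^ (1 / q)) ^ q`, uniform in `q`. -/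
lemma exists_Phi_rpow_mul_le_setLIntegral (n : ℕ) :
    ∃ C : ℝ, 0 < C ∧ ∀ {X : Type*} [MeasurableSpace X] (μ : Measure X) (q : ℝ), 1 ≤ q →
      ∀ u : X → ℝ, Measurable u → (∀ x, 0 ≤ u x) → μ Set.univ ≠ ∞ → ∀ y : ℝ, 0 < y →
      ∫⁻ x, ENNReal.ofReal (u x ^ q) ∂μ = ENNReal.ofReal (y ^ q) * μ Set.univ →
      ENNReal.ofReal (Phi n y ^ q) * μ Set.univ ≤
        ENNReal.ofReal (C ^ q) * ∫⁻ x, ENNReal.ofReal (Phi n (u x) ^ q) ∂μ := by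
  have hP2 : 0 < Phi n 2 := lt_of_lt_of_le (by norm_num) (self_le_Phi n (by norm_num))
  refine ⟨2 * (2 ^ (n - 1) * Phi n 2), by positivity, ?_⟩
  intro X _ μ q hq u hu hu0 hμ y hy hint
  have hq0 : 0 < q := by linarith
  set v := μ Set.univ with hv
  -- K is the slope Φ(t)/t at t = y/2. Where u ≥ y/2, Φ(u) ≥ K u; the remaining points contribute at
  -- most (y/2)^q ≤ y^q / 2 to the average of u^q. No convexity is needed.
  set K : ℝ := 1 + Real.posLog (y / 2) ^ (n - 1) with hK
  have hK1 : 1 ≤ K := le_add_of_nonneg_right (pow_nonneg Real.posLog_nonneg _)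
  have hK0 : 0 < K := by linarith
  set I := ∫⁻ x, ENNReal.ofReal (Phi n (u x) ^ q) ∂μ with hI
  have hpt (x : X) : K ^ q * u x ^ q ≤ Phi n (u x) ^ q + K ^ q * (y / 2) ^ q := by
    have hux := hu0 x
    have hP := Phi_nonneg n hux
    rcases le_total (u x) (y / 2) with hle | hle
    · have h1 : u x ^ q ≤ (y / 2) ^ q := Real.rpow_le_rpow hux hle hq0.le
      have h2 : 0 ≤ Phi n (u x) ^ q := by positivity
      have h3 : K ^ q * u x ^ q ≤ K ^ q * (y / 2) ^ q := by gcongr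
      linarith
    · have h1 : K * u x ≤ Phi n (u x) := by
        have h2 := Real.posLog_le_posLog (by positivity) hle
        have h3 : 0 ≤ Real.posLog (y / 2) := Real.posLog_nonneg
        rw [Phi, mul_comm]
        gcongr
        rw [hK]
        gcongr
      rw [← Real.mul_rpow hK0.le hux]
      have h2 : (K * u x) ^ q ≤ Phi n (u x) ^ q := Real.rpow_le_rpow (by positivity) h1 hq0.le
      have h3 : 0 ≤ K ^ q * (y / 2) ^ q := by positivity
      linarith
  have h1 : ENNReal.ofReal (K ^ q * y ^ q) * v ≤
      I + ENNReal.ofReal (K ^ q * (y / 2) ^ q) * v := by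
    calc ENNReal.ofReal (K ^ q * y ^ q) * v
        = ∫⁻ x, ENNReal.ofReal (K ^ q * u x ^ q) ∂μ := by
          rw [ENNReal.ofReal_mul (by positivity), mul_assoc, ← hint,
            ← lintegral_const_mul _ (hu.pow_const q).ennreal_ofReal]
          exact lintegral_congr fun x => (ENNReal.ofReal_mul (by positivity)).symm
      _ ≤ ∫⁻ x, (ENNReal.ofReal (Phi n (u x) ^ q) + ENNReal.ofReal (K ^ q * (y / 2) ^ q)) ∂μ := by
          refine lintegral_mono fun x => ?_
          have := Phi_nonneg n (hu0 x)
          rw [← ENNReal.ofReal_add (by positivity) (by positivity)]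
          exact ENNReal.ofReal_le_ofReal (hpt x)
      _ = _ := by
          rw [lintegral_add_right _ measurable_const, lintegral_const]
  have hyq : (y / 2) ^ q ≤ y ^ q / 2 := by
    rw [Real.div_rpow hy.le (by norm_num)]
    have : (2 : ℝ) ≤ 2 ^ q := by
      simpa using Real.rpow_le_rpow_of_exponent_le (by norm_num : (1 : ℝ) ≤ 2) hq
    gcongr
  have h2 : ENNReal.ofReal (K ^ q * y ^ q / 2) * v ≤ I := by
    have hfin : ENNReal.ofReal (K ^ q * y ^ q / 2) * v ≠ ∞ :=
      ENNReal.mul_ne_top ENNReal.ofReal_ne_top hμ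
    refine (ENNReal.add_le_add_iff_right hfin).1 ?_
    rw [← add_mul, ← ENNReal.ofReal_add (by positivity) (by positivity), add_halves]
    refine h1.trans ?_
    gcongr
    rw [mul_div_assoc]
    gcongr
  have h3 : Phi n y ^ q ≤ (2 * (2 ^ (n - 1) * Phi n 2)) ^ q * (K ^ q * y ^ q / 2) := by
    have h4 : Phi n y ≤ 2 ^ (n - 1) * Phi n 2 * (K * y) := by
      calc Phi n y = Phi n (2 * (y / 2)) := by congr 1; ring
        _ ≤ 2 ^ (n - 1) * Phi n 2 * Phi n (y / 2) := Phi_mul_le n (by norm_num) (by positivity)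
        _ ≤ 2 ^ (n - 1) * Phi n 2 * (K * y) := by
            gcongr
            rw [Phi, mul_comm]
            gcongr
            linarith
    have h5 : (2 : ℝ) ≤ 2 ^ q := by
      simpa using Real.rpow_le_rpow_of_exponent_le (by norm_num : (1 : ℝ) ≤ 2) hq
    calc Phi n y ^ q ≤ (2 ^ (n - 1) * Phi n 2 * (K * y)) ^ q :=
          Real.rpow_le_rpow (Phi_nonneg n hy.le) h4 hq0.le
      _ = (2 ^ (n - 1) * Phi n 2) ^ q * (K ^ q * y ^ q) := by
          rw [Real.mul_rpow (by positivity) (by positivity), Real.mul_rpow hK0.le hy.le]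
      _ = 2 * (2 ^ (n - 1) * Phi n 2) ^ q * (K ^ q * y ^ q / 2) := by ring
      _ ≤ 2 ^ q * (2 ^ (n - 1) * Phi n 2) ^ q * (K ^ q * y ^ q / 2) := by gcongr
      _ = _ := by rw [← Real.mul_rpow (by norm_num) (by positivity)]
  calc ENNReal.ofReal (Phi n y ^ q) * v
      ≤ ENNReal.ofReal ((2 * (2 ^ (n - 1) * Phi n 2)) ^ q * (K ^ q * y ^ q / 2)) * v := by gcongr
    _ = ENNReal.ofReal ((2 * (2 ^ (n - 1) * Phi n 2)) ^ q) *
          (ENNReal.ofReal (K ^ q * y ^ q / 2) * v) := by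
        rw [ENNReal.ofReal_mul (by positivity), mul_assoc]
    _ ≤ _ := by gcongr

end Integral

/-! ### Hölder's inequality with exponents p/(p+1) and 1/(p+1). -/

section Hoelder

lemma rpow_mul_rpow_ofReal_mul {p x y : ℝ} (hp : 0 < p) (hx : 0 ≤ x) (hy : 0 ≤ y) (v w : ℝ≥0∞) :
    (ENNReal.ofReal x * v) ^ (p / (p + 1)) * (ENNReal.ofReal (y ^ p) * w) ^ (1 / (p + 1)) =
      ENNReal.ofReal ((x * y) ^ (p / (p + 1))) * (v ^ (p / (p + 1)) * w ^ (1 / (p + 1))) := by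
  have h1 : 0 ≤ p / (p + 1) := by positivity
  have h2 : 0 ≤ 1 / (p + 1) := by positivity
  rw [ENNReal.mul_rpow_of_nonneg _ _ h1, ENNReal.mul_rpow_of_nonneg _ _ h2,
    ENNReal.ofReal_rpow_of_nonneg hx h1, ENNReal.ofReal_rpow_of_nonneg (by positivity) h2,
    ← Real.rpow_mul hy, mul_one_div, Real.mul_rpow hx hy, ENNReal.ofReal_mul (by positivity)]
  ring

lemma rpow_mul_rpow_self {p : ℝ} (hp : 0 < p) (v : ℝ≥0∞) :
    v ^ (p / (p + 1)) * v ^ (1 / (p + 1)) = v := by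
  rw [← ENNReal.rpow_add_of_nonneg _ _ (by positivity) (by positivity), ← add_div,
    div_self (by positivity), ENNReal.rpow_one]

lemma sum_rpow_mul_rpow_le {β : Type*} (t : Finset β) (a b : β → ℝ≥0∞) {p : ℝ} (hp : 0 < p) :
    ∑ i ∈ t, a i ^ (p / (p + 1)) * b i ^ (1 / (p + 1)) ≤
      (∑ i ∈ t, a i) ^ (p / (p + 1)) * (∑ i ∈ t, b i) ^ (1 / (p + 1)) := by
  have hpq : ((p + 1) / p).HolderConjugate (p + 1) := by
    rw [Real.holderConjugate_iff]
    constructor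
    · rw [lt_div_iff₀ hp]; linarith
    · field_simp
  have := ENNReal.inner_le_Lp_mul_Lq t (fun i => a i ^ (p / (p + 1)))
    (fun i => b i ^ (1 / (p + 1))) hpq
  simp only [← ENNReal.rpow_mul] at this
  have h1 : p / (p + 1) * ((p + 1) / p) = 1 := by field_simp
  have h2 : 1 / (p + 1) * (p + 1) = 1 := by field_simp
  have h3 : 1 / ((p + 1) / p) = p / (p + 1) := one_div_div _ _
  simpa only [h1, h2, h3, ENNReal.rpow_one] using this

/-- Hölder replaces ∫ G by v^(1-1/p) (∫ G^p)^(1/p). Cancelling that power of v and raising to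
p/(p+1) makes the left side exactly v. -/
lemma le_rpow_mul_rpow_of_sq_le {X : Type*} [MeasurableSpace X] {μ : Measure X}
    {F : ℝ≥0∞} {G : X → ℝ≥0∞} (hG : AEMeasurable G μ) {p : ℝ} (hp : 1 ≤ p)
    (hμ : μ Set.univ ≠ ∞) (h : μ Set.univ ^ 2 ≤ F * ∫⁻ x, G x ∂μ) :
    μ Set.univ ≤ F ^ (p / (p + 1)) * (∫⁻ x, G x ^ p ∂μ) ^ (1 / (p + 1)) := by
  have hp0 : 0 < p := by linarith
  set v := μ Set.univ with hv
  rcases eq_or_ne v 0 with h0 | h0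
  · simp [h0]
  set J := ∫⁻ x, G x ^ p ∂μ with hJ
  have hp1 : 0 ≤ 1 - 1 / p := sub_nonneg.2 ((div_le_one hp0).2 hp)
  have h1 : ∫⁻ x, G x ∂μ ≤ v ^ (1 - 1 / p) * J ^ (1 / p) := by
    have := ENNReal.lintegral_mul_norm_pow_le (μ := μ) (f := fun _ => 1) (g := fun x => G x ^ p)
      aemeasurable_const (hG.pow_const p) hp1 (by positivity : 0 ≤ 1 / p) (by ring)
    simpa [← ENNReal.rpow_mul, mul_inv_cancel₀ hp0.ne'] using this
  have h2 : v ^ (1 - 1 / p) * v ^ (1 + 1 / p) ≤ v ^ (1 - 1 / p) * (F * J ^ (1 / p)) := by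
    calc v ^ (1 - 1 / p) * v ^ (1 + 1 / p) = v ^ 2 := by
          rw [← ENNReal.rpow_add _ _ h0 hμ, ← ENNReal.rpow_natCast]
          congr 1
          push_cast
          ring
      _ ≤ F * (v ^ (1 - 1 / p) * J ^ (1 / p)) := h.trans (by gcongr)
      _ = _ := by ring
  have h3 : v ^ (1 + 1 / p) ≤ F * J ^ (1 / p) :=
    (ENNReal.mul_le_mul_iff_right (by simp [ENNReal.rpow_eq_zero_iff, h0, hμ])
      (ENNReal.rpow_ne_top_of_nonneg hp1 hμ)).1 h2
  have h4 := ENNReal.rpow_le_rpow h3 (by positivity : 0 ≤ p / (p + 1))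
  rw [ENNReal.mul_rpow_of_nonneg _ _ (by positivity), ← ENNReal.rpow_mul, ← ENNReal.rpow_mul] at h4
  have e1 : (1 + 1 / p) * (p / (p + 1)) = 1 := by field_simp
  have e2 : 1 / p * (p / (p + 1)) = 1 / (p + 1) := by field_simp
  rwa [e1, e2, ENNReal.rpow_one] at h4

end Hoelder

/-! ### The endpoint inequality and the passage to the maximal function. -/

section Main

/-- The value `y` with `y ^ q` the average of a function with integral `I` over a set of
measure `v`. -/
lemma exists_rpow_mul_eq {I v : ℝ≥0∞} (hI0 : I ≠ 0) (hI : I ≠ ∞) (hv0 : v ≠ 0) (hv : v ≠ ∞)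
    {q : ℝ} (hq : 0 < q) : ∃ y : ℝ, 0 < y ∧ I = ENNReal.ofReal (y ^ q) * v := by
  have hfin : I / v ≠ ∞ := ENNReal.div_ne_top hI hv0
  have hpos : 0 < (I / v).toReal := ENNReal.toReal_pos (ENNReal.div_ne_zero.2 ⟨hI0, hv⟩) hfin
  refine ⟨(I / v).toReal ^ (1 / q), by positivity, ?_⟩
  rw [← Real.rpow_mul hpos.le, one_div_mul_cancel hq.ne', Real.rpow_one, ENNReal.ofReal_toReal hfin,
    ENNReal.div_mul_cancel hv0 hv]

lemma setLIntegral_eq_zero_of_Phi {n : ℕ} {A B : Set (Fin n → ℝ)} (hAB : A ⊆ B) (q : ℝ)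
    {F : (Fin n → ℝ) → ℝ} (hF : Measurable F) (hF0 : ∀ x, 0 ≤ F x)
    (h : ∫⁻ x in B, ENNReal.ofReal (Phi n (F x) ^ q) = 0) :
    ∫⁻ x in A, ENNReal.ofReal (F x) = 0 := by
  have hm : Measurable fun x => ENNReal.ofReal (Phi n (F x) ^ q) :=
    (((measurable_Phi n).comp hF).pow_const q).ennreal_ofReal
  have h1 := (lintegral_eq_zero_iff hm).1 (le_antisymm ((lintegral_mono_set hAB).trans h.le)
    zero_le)
  rw [lintegral_eq_zero_iff hF.ennreal_ofReal]
  filter_upwards [h1] with x hx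
  have h2 : 0 ≤ Phi n (F x) := Phi_nonneg n (hF0 x)
  simp only [Pi.zero_apply, ENNReal.ofReal_eq_zero] at hx ⊢
  by_contra! hlt
  exact absurd hx (not_le.2 (Real.rpow_pos_of_pos (hlt.trans_le (self_le_Phi n (hF0 x))) q))

/-- The endpoint inequality for finite families of rectangles. -/
theorem exists_volume_biUnion_box_le (n : ℕ) (hn : 1 ≤ n) :
    ∃ C : ℝ, 0 < C ∧ ∀ p : ℝ, 1 < p → ∀ F G : (Fin n → ℝ) → ℝ, Measurable F → Measurable G →
      (∀ x, 0 ≤ F x) → (∀ x, 0 ≤ G x) → ∀ s : Finset (Fin n → ℝ × ℝ),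
      (∀ R ∈ s, volume (box R) ^ 2 ≤
        (∫⁻ x in box R, ENNReal.ofReal (F x)) * ∫⁻ x in box R, ENNReal.ofReal (G x)) →
      volume (⋃ R ∈ s, box R) ≤ ENNReal.ofReal C *
        (∫⁻ x, ENNReal.ofReal (Phi n (Phi n (F x)))) ^ (p / (p + 1)) *
        (∫⁻ x, ENNReal.ofReal (Phi n (Phi n (G x)) ^ p)) ^ (1 / (p + 1)) := by
  have : Nonempty (Fin n) := ⟨⟨0, hn⟩⟩
  obtain ⟨A, hA1, hA⟩ := exists_sum_setLIntegral_rpow_box_le n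
  obtain ⟨J, hJ0, hJ⟩ := exists_Phi_rpow_mul_le_setLIntegral n
  obtain ⟨c, hc0, hc⟩ := exists_le_Phi_mul_Phi n (c := (A * A)⁻¹) (by positivity)
  set Q : ℝ≥0∞ := 12 * (6 ^ n * dyadicGrowth n (2 ^ n * 4)) with hQ
  have hQt : Q ≠ ∞ := by
    refine ENNReal.mul_ne_top (by norm_num) (ENNReal.mul_ne_top (by simp) ?_)
    rw [show (2 : ℝ≥0∞) ^ n * 4 = ENNReal.ofReal (2 ^ n * 4) by
      rw [ENNReal.ofReal_mul (by positivity), ENNReal.ofReal_pow (by norm_num)]; simp]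
    exact ne_top_of_le_ne_top ENNReal.ofReal_ne_top (dyadicGrowth_ofReal_le n _)
  -- The maximum with 1 bounds (J * J / c)^(p/(p+1)) by E for every p.
  set E : ℝ := max 1 (J * J / c) with hE
  have hE1 : 1 ≤ E := le_max_left _ _
  refine ⟨(Q.toReal + 1) * E, by positivity, ?_⟩
  intro p hp F G hF hG hF0 hG0 s hs
  have hp0 : 0 < p := by linarith
  have hr : 0 < p / (p + 1) := by positivity
  have hr' : 0 < 1 / (p + 1) := by positivity
  have hr1 : p / (p + 1) ≤ 1 := by rw [div_le_one (by positivity)]; linarith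
  set X := ∫⁻ x, ENNReal.ofReal (Phi n (Phi n (F x))) with hX
  set Y := ∫⁻ x, ENNReal.ofReal (Phi n (Phi n (G x)) ^ p) with hY
  obtain ⟨t, hts, hvol, hcov⟩ := exists_subset_box_covering s
  simp only [Fintype.card_fin] at hvol hcov
  set Ω := ⋃ R ∈ t, box R with hΩ
  have hΩm : MeasurableSet Ω := measurableSet_biUnion_box t
  have hsub {R} (hR : R ∈ t) : box R ⊆ Ω := Set.subset_biUnion_of_mem (u := box) hR
  set v := volume Ω with hv
  have hvsum : v ≤ ∑ R ∈ t, volume (box R) := measure_biUnion_finset_le _ _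
  have hvt : v ≠ ∞ := ne_top_of_le_ne_top
    (ENNReal.sum_ne_top.2 fun R _ => volume_box_ne_top R) hvsum
  suffices hmain : v ≤ ENNReal.ofReal E * X ^ (p / (p + 1)) * Y ^ (1 / (p + 1)) by
    refine hvol.trans ?_
    rw [ENNReal.ofReal_mul (by positivity), mul_assoc (ENNReal.ofReal _),
      mul_assoc (ENNReal.ofReal _)]
    refine mul_le_mul' ?_ hmain
    rw [ENNReal.ofReal_add (by positivity) (by norm_num), ENNReal.ofReal_toReal hQt]
    exact le_self_add
  rcases eq_or_ne v 0 with hv0 | hv0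
  · rw [hv0]
    exact zero_le
  have hPF (x) : 0 ≤ Phi n (F x) := Phi_nonneg n (hF0 x)
  have hPG (x) : 0 ≤ Phi n (G x) := Phi_nonneg n (hG0 x)
  have hPFm : Measurable fun x => Phi n (F x) := (measurable_Phi n).comp hF
  have hPGm : Measurable fun x => Phi n (G x) := (measurable_Phi n).comp hG
  set a := ∫⁻ x in Ω, ENNReal.ofReal (Phi n (F x) ^ (1 : ℝ)) with ha
  set b := ∫⁻ x in Ω, ENNReal.ofReal (Phi n (G x) ^ p) with hb
  -- If all these products vanished, the selected boxes would be null, against v ≠ 0. Since Φ(t) ≥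
  -- t, this excludes a = 0 and b = 0, so the averages x₁ and y₁ below are positive.
  have hne (h : ∀ R ∈ t, (∫⁻ x in box R, ENNReal.ofReal (F x)) *
      ∫⁻ x in box R, ENNReal.ofReal (G x) = 0) : False := by
    refine hv0 (le_antisymm (hvsum.trans (le_of_eq ?_)) zero_le)
    refine Finset.sum_eq_zero fun R hR => ?_
    have := hs R (hts hR)
    rw [h R hR] at this
    exact pow_eq_zero_iff two_ne_zero |>.1 (le_antisymm this zero_le)
  have ha0 : a ≠ 0 := fun h => hne fun R hR => by
    rw [setLIntegral_eq_zero_of_Phi (hsub hR) 1 hF hF0 h, zero_mul]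
  have hb0 : b ≠ 0 := fun h => hne fun R hR => by
    rw [setLIntegral_eq_zero_of_Phi (hsub hR) p hG hG0 h, mul_zero]
  have haX : a ≤ X := by
    refine (setLIntegral_le_lintegral _ _).trans (lintegral_mono fun x => ?_)
    rw [Real.rpow_one]
    exact ENNReal.ofReal_le_ofReal (self_le_Phi n (hPF x))
  have hbY : b ≤ Y := by
    refine (setLIntegral_le_lintegral _ _).trans (lintegral_mono fun x => ?_)
    exact ENNReal.ofReal_le_ofReal
      (Real.rpow_le_rpow (hPG x) (self_le_Phi n (hPG x)) hp0.le)
  have hX0 : X ≠ 0 := fun h => ha0 (le_antisymm (haX.trans h.le) zero_le)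
  have hY0 : Y ≠ 0 := fun h => hb0 (le_antisymm (hbY.trans h.le) zero_le)
  have hE0 : ENNReal.ofReal E ≠ 0 := by
    simpa using zero_lt_one.trans_le hE1
  rcases eq_or_ne X ∞ with hXt | hXt
  · rw [hXt, ENNReal.top_rpow_of_pos hr, ENNReal.mul_top hE0, ENNReal.top_mul]
    · exact le_top
    · simp [ENNReal.rpow_eq_zero_iff, hY0, hp0.le, add_nonneg]
  rcases eq_or_ne Y ∞ with hYt | hYt
  · rw [hYt, ENNReal.top_rpow_of_pos hr', ENNReal.mul_top]
    · exact le_top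
    · exact mul_ne_zero hE0 (by simp [ENNReal.rpow_eq_zero_iff, hX0, hXt])
  obtain ⟨x₁, hx₁, hax⟩ := exists_rpow_mul_eq ha0 (ne_top_of_le_ne_top hXt haX) hv0 hvt one_pos
  obtain ⟨y₁, hy₁, hby⟩ := exists_rpow_mul_eq hb0 (ne_top_of_le_ne_top hYt hbY) hv0 hvt hp0
  have hdx : 0 < dualPhi n x₁ := hx₁.trans_le (self_le_dualPhi n hx₁.le)
  have hdy : 0 < dualPhi n y₁ := hy₁.trans_le (self_le_dualPhi n hy₁.le)
  have hSF := hA 1 le_rfl F hF hF0 t hcov x₁ hx₁ hax.le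
  have hSG := hA p hp.le G hG hG0 t hcov y₁ hy₁ hby.le
  simp only [Real.rpow_one] at hSF
  -- Both Hölder steps and the two overlap bounds return v times a power of this product; as v is
  -- positive and finite, the product cannot be below 1.
  have hone : 1 ≤ (A * dualPhi n x₁) * (A * dualPhi n y₁) := by
    have h1 : v ≤ ENNReal.ofReal (((A * dualPhi n x₁) * (A * dualPhi n y₁)) ^ (p / (p + 1))) *
        v := by
      calc v ≤ ∑ R ∈ t, volume (box R) := hvsum
        _ ≤ ∑ R ∈ t, (∫⁻ x in box R, ENNReal.ofReal (F x)) ^ (p / (p + 1)) *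
              (∫⁻ x in box R, ENNReal.ofReal (G x ^ p)) ^ (1 / (p + 1)) := by
            refine Finset.sum_le_sum fun R hR => ?_
            have := le_rpow_mul_rpow_of_sq_le (μ := volume.restrict (box R))
              (F := ∫⁻ x in box R, ENNReal.ofReal (F x)) (G := fun x => ENNReal.ofReal (G x))
              hG.ennreal_ofReal.aemeasurable hp.le (by simpa using volume_box_ne_top R)
              (by simpa using hs R (hts hR))
            simp only [Measure.restrict_apply_univ] at this
            refine this.trans (le_of_eq ?_)
            congr 2
            exact lintegral_congr fun x => ENNReal.ofReal_rpow_of_nonneg (hG0 x) hp0.le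
        _ ≤ _ := sum_rpow_mul_rpow_le t _ _ hp0
        _ ≤ (ENNReal.ofReal (A * dualPhi n x₁) * v) ^ (p / (p + 1)) *
              (ENNReal.ofReal ((A * dualPhi n y₁) ^ p) * v) ^ (1 / (p + 1)) := by gcongr
        _ = _ := by
            rw [rpow_mul_rpow_ofReal_mul hp0 (by positivity) (by positivity),
              rpow_mul_rpow_self hp0]
    by_contra! hlt
    have h2 : ENNReal.ofReal (((A * dualPhi n x₁) * (A * dualPhi n y₁)) ^ (p / (p + 1))) < 1 := by
      rw [← ENNReal.ofReal_one]
      exact (ENNReal.ofReal_lt_ofReal_iff one_pos).2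
        (Real.rpow_lt_one (by positivity) hlt hr)
    have h3 := ENNReal.mul_lt_mul_left hv0 hvt h2
    rw [one_mul] at h3
    exact absurd h1 (not_le.2 h3)
  have hcc : c ≤ Phi n x₁ * Phi n y₁ := by
    refine hc x₁ y₁ hx₁ hy₁ ?_
    rw [inv_le_iff_one_le_mul₀ (by positivity)]
    linarith
  have hPx := Phi_nonneg n hx₁.le
  have hPy := Phi_nonneg n hy₁.le
  have hJF : ENNReal.ofReal (Phi n x₁) * v ≤ ENNReal.ofReal J * X := by
    have := hJ (volume.restrict Ω) 1 le_rfl _ hPFm hPF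
      (by simpa using hvt) x₁ hx₁ (by simpa [ha, hv] using hax)
    simp only [Real.rpow_one, Measure.restrict_apply_univ] at this
    exact this.trans (by gcongr; exact setLIntegral_le_lintegral _ _)
  have hJG : ENNReal.ofReal (Phi n y₁ ^ p) * v ≤ ENNReal.ofReal (J ^ p) * Y := by
    have := hJ (volume.restrict Ω) p hp.le _ hPGm hPG
      (by simpa using hvt) y₁ hy₁ (by simpa [hb, hv] using hby)
    simp only [Measure.restrict_apply_univ] at this
    exact this.trans (by gcongr; exact setLIntegral_le_lintegral _ _)
  have hfin : ENNReal.ofReal (c ^ (p / (p + 1))) * v ≤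
      ENNReal.ofReal ((J * J) ^ (p / (p + 1))) * (X ^ (p / (p + 1)) * Y ^ (1 / (p + 1))) := by
    calc ENNReal.ofReal (c ^ (p / (p + 1))) * v
        ≤ ENNReal.ofReal ((Phi n x₁ * Phi n y₁) ^ (p / (p + 1))) * v := by gcongr
      _ = (ENNReal.ofReal (Phi n x₁) * v) ^ (p / (p + 1)) *
            (ENNReal.ofReal (Phi n y₁ ^ p) * v) ^ (1 / (p + 1)) := by
          rw [rpow_mul_rpow_ofReal_mul hp0 hPx hPy, rpow_mul_rpow_self hp0]
      _ ≤ (ENNReal.ofReal J * X) ^ (p / (p + 1)) *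
            (ENNReal.ofReal (J ^ p) * Y) ^ (1 / (p + 1)) := by gcongr
      _ = _ := rpow_mul_rpow_ofReal_mul hp0 hJ0.le hJ0.le _ _
  have hcr : 0 < c ^ (p / (p + 1)) := by positivity
  have hcr0 : ENNReal.ofReal (c ^ (p / (p + 1))) ≠ 0 := by simpa using hcr
  refine (ENNReal.mul_le_mul_iff_right hcr0 ENNReal.ofReal_ne_top).1 (hfin.trans ?_)
  rw [mul_assoc (ENNReal.ofReal E), ← mul_assoc (ENNReal.ofReal (c ^ _)),
    ← ENNReal.ofReal_mul hcr.le]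
  gcongr
  have h1 : (J * J / c) ^ (p / (p + 1)) ≤ E := by
    calc (J * J / c) ^ (p / (p + 1)) ≤ E ^ (p / (p + 1)) := by
          gcongr
          exact le_max_right _ _
      _ ≤ E ^ (1 : ℝ) := Real.rpow_le_rpow_of_exponent_le hE1 hr1
      _ = E := Real.rpow_one E
  calc (J * J) ^ (p / (p + 1)) = c ^ (p / (p + 1)) * (J * J / c) ^ (p / (p + 1)) := by
        rw [← Real.mul_rpow hc0.le (by positivity), mul_div_cancel₀ _ hc0.ne']
    _ ≤ _ := by gcongr

lemma exists_eq_box_of_mem_openRectangles {n : ℕ} {S : Set (Fin n → ℝ)}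
    (hS : S ∈ openRectangles n) : ∃ R : Fin n → ℝ × ℝ, S = box R := by
  obtain ⟨a, b, _, rfl⟩ := hS
  exact ⟨fun i => (a i, b i), (box_eq_pi fun i => (a i, b i)).symm⟩

lemma isOpen_box {ι : Type*} [Fintype ι] (R : ι → ℝ × ℝ) : IsOpen (box R) := by
  rw [box_eq_pi]
  exact isOpen_set_pi Set.finite_univ fun i _ => isOpen_Ioo

lemma setOf_lt_strongMaximal_subset {n m : ℕ} (f : Fin m → (Fin n → ℝ) → ℂ) (c : ℝ≥0∞) :
    {x | c < strongMaximal f x} ⊆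
      ⋃ R : {R : Fin n → ℝ × ℝ // c < ∏ i, ⨍⁻ y in box R, ‖f i y‖ₑ ∂volume}, box R.1 := by
  intro x hx
  have hx' : c < strongMaximal f x := hx
  simp only [strongMaximal, lt_iSup_iff] at hx'
  obtain ⟨S, hS, hxS, hc⟩ := hx'
  obtain ⟨R, rfl⟩ := exists_eq_box_of_mem_openRectangles hS
  exact Set.mem_iUnion.2 ⟨⟨R, hc⟩, hxS⟩

/-- If a product of two averages over a rectangle exceeds `α`, the normalised functions satisfy the
hypothesis of the inequality for finite families. -/
lemma volume_box_sq_le {n : ℕ} {f g : (Fin n → ℝ) → ℂ} {α : ℝ} (hα : 0 < α) {R : Fin n → ℝ × ℝ}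
    (h : ENNReal.ofReal α < ∏ i : Fin 2, ⨍⁻ y in box R, ‖(![f, g] : Fin 2 → _) i y‖ₑ ∂volume) :
    volume (box R) ^ 2 ≤ (∫⁻ x in box R, ENNReal.ofReal (‖f x‖ / √α)) *
      ∫⁻ x in box R, ENNReal.ofReal (‖g x‖ / √α) := by
  have hs : 0 < √α := Real.sqrt_pos.2 hα
  have hs0 : ENNReal.ofReal (√α) ≠ 0 := by simpa using hs
  have hint (u : (Fin n → ℝ) → ℂ) : ∫⁻ x in box R, ‖u x‖ₑ =
      ENNReal.ofReal √α * ∫⁻ x in box R, ENNReal.ofReal (‖u x‖ / √α) := by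
    rw [← lintegral_const_mul' _ _ ENNReal.ofReal_ne_top]
    refine lintegral_congr fun x => ?_
    rw [← ENNReal.ofReal_mul hs.le, mul_div_cancel₀ _ hs.ne', ofReal_norm]
  rw [Fin.prod_univ_two] at h
  simp only [Matrix.cons_val_zero, Matrix.cons_val_one, setLAverage_eq, hint] at h
  set v := volume (box R)
  rcases eq_or_ne v 0 with hv0 | hv0
  · simp [hv0]
  have hvt : v ≠ ∞ := volume_box_ne_top R
  set I := ∫⁻ x in box R, ENNReal.ofReal (‖f x‖ / √α)
  set J := ∫⁻ x in box R, ENNReal.ofReal (‖g x‖ / √α)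
  have hα0 : ENNReal.ofReal α ≠ 0 := by simpa using hα
  have hαs : ENNReal.ofReal √α * ENNReal.ofReal √α = ENNReal.ofReal α := by
    rw [← ENNReal.ofReal_mul hs.le, Real.mul_self_sqrt hα.le]
  refine (ENNReal.mul_le_mul_iff_right hα0 ENNReal.ofReal_ne_top).1 ?_
  calc ENNReal.ofReal α * v ^ 2
      ≤ ENNReal.ofReal √α * I / v * (ENNReal.ofReal √α * J / v) * v ^ 2 := by gcongr
    _ = (ENNReal.ofReal √α * I / v * v) * (ENNReal.ofReal √α * J / v * v) := by ring
    _ = (ENNReal.ofReal √α * I) * (ENNReal.ofReal √α * J) := by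
        rw [ENNReal.div_mul_cancel hv0 hvt, ENNReal.div_mul_cancel hv0 hvt]
    _ = ENNReal.ofReal α * (I * J) := by
        rw [← hαs]; ring

lemma isOpen_setOf_lt_strongMaximal {n m : ℕ} (f : Fin m → (Fin n → ℝ) → ℂ) (c : ℝ≥0∞) :
    IsOpen {x | c < strongMaximal f x} := by
  rw [isOpen_iff_forall_mem_open]
  intro x hx
  have hx' : c < strongMaximal f x := hx
  simp only [strongMaximal, lt_iSup_iff] at hx'
  obtain ⟨S, hS, hxS, hc⟩ := hx'
  obtain ⟨R, rfl⟩ := exists_eq_box_of_mem_openRectangles hS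
  refine ⟨box R, fun z hz => ?_, isOpen_box R, hxS⟩
  change c < strongMaximal f z
  simp only [strongMaximal, lt_iSup_iff]
  exact ⟨box R, hS, hz, hc⟩

theorem mainTheorem7 (n : ℕ) (hn : 1 ≤ n) :
    ∃ C : ℝ, 0 < C ∧
      ∀ p : ℝ, 1 < p →
        ∀ f g : (Fin n → ℝ) → ℂ,
          MemLPhi (PhiIter n 2) 1 f → MemLPhi (PhiIter n 2) p g →
            ∀ α : ℝ, 0 < α →
              volume {x : Fin n → ℝ | ENNReal.ofReal α < strongMaximal ![f, g] x} ≤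
                ENNReal.ofReal C *
                  (∫⁻ x, ENNReal.ofReal (PhiIter n 2 (‖f x‖ / √α))) ^ (p / (p + 1)) *
                  (∫⁻ x, ENNReal.ofReal (PhiIter n 2 (‖g x‖ / √α)) ^ p) ^ (1 / (p + 1)) := by
  classical
  obtain ⟨C, hC0, hC⟩ := exists_volume_biUnion_box_le n hn
  refine ⟨C, hC0, fun p hp f g hf hg α hα => ?_⟩
  -- The inequality for finite families needs measurable functions; passing to such representatives
  -- changes no integral.
  obtain ⟨f', hf'm, hff'⟩ := hf.1
  obtain ⟨g', hg'm, hgg'⟩ := hg.1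
  have hp0 : 0 ≤ p := by linarith
  have hF0 (x) : 0 ≤ ‖f' x‖ / √α := by positivity
  have hG0 (x) : 0 ≤ ‖g' x‖ / √α := by positivity
  have hIf : ∫⁻ x, ENNReal.ofReal (PhiIter n 2 (‖f x‖ / √α)) =
      ∫⁻ x, ENNReal.ofReal (Phi n (Phi n (‖f' x‖ / √α))) := by
    refine lintegral_congr_ae ?_
    filter_upwards [hff'] with x hx
    rw [hx]
    rfl
  have hIg : ∫⁻ x, ENNReal.ofReal (PhiIter n 2 (‖g x‖ / √α)) ^ p =
      ∫⁻ x, ENNReal.ofReal (Phi n (Phi n (‖g' x‖ / √α)) ^ p) := by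
    refine lintegral_congr_ae ?_
    filter_upwards [hgg'] with x hx
    rw [hx, ← ENNReal.ofReal_rpow_of_nonneg (Phi_nonneg n (Phi_nonneg n (hG0 x))) hp0]
    rfl
  rw [hIf, hIg, (isOpen_setOf_lt_strongMaximal _ _).measure_eq_iSup_isCompact]
  refine iSup₂_le fun K hK => iSup_le fun hKc => ?_
  obtain ⟨s, hs⟩ := hKc.elim_finite_subcover
    (fun R : {R : Fin n → ℝ × ℝ // ENNReal.ofReal α <
      ∏ i, ⨍⁻ y in box R, ‖(![f, g] : Fin 2 → _) i y‖ₑ ∂volume} => box R.1)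
    (fun R => isOpen_box R.1) (hK.trans (setOf_lt_strongMaximal_subset _ _))
  have hcover : K ⊆ ⋃ R ∈ s.image Subtype.val, box R := by
    refine hs.trans (Set.iUnion₂_subset fun R hR => ?_)
    exact Set.subset_biUnion_of_mem (u := box) (Finset.mem_image_of_mem Subtype.val hR)
  refine (measure_mono hcover).trans (hC p hp _ _ (hf'm.measurable.norm.div_const _)
    (hg'm.measurable.norm.div_const _) hF0 hG0 _ fun R hR => ?_)
  obtain ⟨⟨R, hR'⟩, -, rfl⟩ := Finset.mem_image.1 hR
  refine (volume_box_sq_le hα hR').trans_eq ?_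
  congr 1
  · refine lintegral_congr_ae (ae_restrict_of_ae ?_)
    filter_upwards [hff'] with x hx
    rw [hx]
  · refine lintegral_congr_ae (ae_restrict_of_ae ?_)
    filter_upwards [hgg'] with x hx
    rw [hx]

end Main
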